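/- Let $\kappa>0$ (the wave number), $R>0$, $\alpha>0$ and let $k\ge 0$ be an integer. Let $P_n$ be the Legendre polynomials, $j_n,y_n$ the spherical Bessel functions and $h_n^{(1)}=j_n+iy_n$. Let $(m_l)_{l\ge0}$ and $(u_s)_{s\ge0}$ be sequences of measurable complex-valued functions on $[0,R]$ with $$\sup_{0\le\rho\le R}|m_l(\rho)|\le \frac{A}{l^{k+2+\alpha}}\quad(l\ge1),\qquad \sup_{0\le\rho\le R}|u_s(\rho)|\le \frac{B}{s^{k+4+\alpha}}\quad(s\ge1),$$ and put $m(\rho,\theta)=\sum_{l\ge0}m_l(\rho)P_l(\cos\theta)$ and, for an integer $F\ge1$, $u^T(\rho,\theta)=\sum_{s>F}u_s(\rho)P_s(\cos\theta)$. For a function $v(\rho,\theta)$ and $\tilde\rho\ge0$ let $$(K_nv)(\tilde\rho)=-(2n+1)\kappa^3\int_0^R h_n^{(1)}(\kappa\max(\tilde\rho,\rho))\,j_n(\kappa\min(\tilde\rho,\rho))\,\rho^2\int_0^\pi v(\rho,\theta)\,m(\rho,\theta)\,P_n(\cos\theta)\sin\theta\,d\theta\,d\rho,$$ $$(K^Fv)(\tilde\rho,\theta)=\sum_{n=0}^F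 (K_nv)(\tilde\rho)\,P_n(\cos\theta).$$ Let $\|\cdot\|_\infty$ denote the supremum over all $\tilde\rho\ge0$ and all $\theta$. Then there is a constant $C>0$, depending only on $\kappa,R,k,\alpha$, such that: * if $k\ge1$, then $\displaystyle \|K^Fu^T\|_\infty\le C\,A\,B\;F^{-\left(k+4.5+\alpha+\min(1.5,\,k+\alpha)\right)}$ for all $F\ge1$; * if $k=0$, then $\displaystyle \|K^Fu^T\|_\infty\le C\,A\,B\;\log F\cdot F^{-\left(4.5+\alpha+\min(1,\,0.5+\alpha)\right)}$ for all $F\ge2$. -/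

import Mathlib

open scoped BigOperators

noncomputable section

namespace HelmholtzScattering

/-- The Legendre polynomial `Pₙ`, by Rodrigues' formula. -/
def legendreP (n : ℕ) : Polynomial ℝ :=
  Polynomial.C (1 / (2 ^ n * (n.factorial : ℝ))) *
    Polynomial.derivative^[n] ((Polynomial.X ^ 2 - 1) ^ n)

/-- The spherical Bessel function of the first kind,
`jₙ(x) = xⁿ / (1·3·5⋯(2n+1)) · [1 - (x²/2)/(1!(2n+3)) + (x²/2)²/(2!(2n+3)(2n+5)) - ⋯]`. -/
def sphericalJ (n : ℕ) (x : ℝ) : ℝ :=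
  x ^ n / (∏ i ∈ Finset.range (n + 1), (2 * (i : ℝ) + 1)) *
    ∑' q : ℕ, (-(x ^ 2 / 2)) ^ q /
      ((q.factorial : ℝ) * ∏ i ∈ Finset.range q, (2 * (n : ℝ) + 3 + 2 * (i : ℝ)))

/-- The spherical Bessel function of the second kind (for `x > 0`),
`yₙ(x) = -(1·1·3·5⋯(2n-1)) / xⁿ⁺¹ · [1 - (x²/2)/(1!(1-2n)) + (x²/2)²/(2!(1-2n)(3-2n)) - ⋯]`.
The factors `2i+1-2n` are odd integers, hence never zero. -/
def sphericalY (n : ℕ) (x : ℝ) : ℝ :=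
  -((∏ i ∈ Finset.range n, (2 * (i : ℝ) + 1)) / x ^ (n + 1)) *
    ∑' q : ℕ, (-(x ^ 2 / 2)) ^ q /
      ((q.factorial : ℝ) * ∏ i ∈ Finset.range q, (2 * (i : ℝ) + 1 - 2 * (n : ℝ)))

/-- The spherical Hankel function of the first kind, `hₙ⁽¹⁾ = jₙ + i yₙ`. -/
def sphericalH (n : ℕ) (x : ℝ) : ℂ :=
  (sphericalJ n x : ℂ) + Complex.I * (sphericalY n x : ℂ)

/-- The function `∑_{l ≥ 0} c_l(ρ) P_l(cos θ)` with Legendre coefficients `c_l(ρ)`. -/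
def legendreSeries (c : ℕ → ℝ → ℂ) (ρ θ : ℝ) : ℂ :=
  ∑' l : ℕ, c l ρ * (((legendreP l).eval (Real.cos θ) : ℝ) : ℂ)

/-- The tail `u^T = ∑_{s > F} u_s(ρ) P_s(cos θ)` of a Legendre series. -/
def legendreTail (u : ℕ → ℝ → ℂ) (F : ℕ) (ρ θ : ℝ) : ℂ :=
  ∑' s : ℕ, u (F + 1 + s) ρ * (((legendreP (F + 1 + s)).eval (Real.cos θ) : ℝ) : ℂ)

/-- The angular integral `Iₙ(ρ) = ∫₀^π v(ρ,θ) M(ρ,θ) Pₙ(cos θ) sin θ dθ`. -/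
def angularIntegral (M v : ℝ → ℝ → ℂ) (n : ℕ) (ρ : ℝ) : ℂ :=
  ∫ θ in (0 : ℝ)..Real.pi,
    v ρ θ * M ρ θ * (((legendreP n).eval (Real.cos θ) : ℝ) : ℂ) * ((Real.sin θ : ℝ) : ℂ)

/-- `(Kₙ v)(a) = -(2n+1) κ³ ∫₀^R hₙ⁽¹⁾(κ max(a,ρ)) jₙ(κ min(a,ρ)) Iₙ(ρ) ρ² dρ`,
with wave number `κ`. -/
def radialOperator (κ R : ℝ) (M : ℝ → ℝ → ℂ) (n : ℕ) (v : ℝ → ℝ → ℂ) (a : ℝ) : ℂ :=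
  -((2 * (n : ℂ) + 1) * (κ : ℂ) ^ 3) *
    ∫ ρ in (0 : ℝ)..R,
      sphericalH n (κ * max a ρ) * (sphericalJ n (κ * min a ρ) : ℂ) *
        angularIntegral M v n ρ * (ρ : ℂ) ^ 2

/-- `(K^F v)(a, cos θ) = ∑_{n=0}^{F} (Kₙ v)(a) Pₙ(cos θ)`. -/
def truncatedOperator (κ R : ℝ) (M : ℝ → ℝ → ℂ) (F : ℕ) (v : ℝ → ℝ → ℂ) (a θ : ℝ) : ℂ :=
  ∑ n ∈ Finset.range (F + 1),
    radialOperator κ R M n v a * (((legendreP n).eval (Real.cos θ) : ℝ) : ℂ)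

end HelmholtzScattering

end

/-! ### Legendre polynomials: differential equation, orthogonality, triple products. -/

namespace HelmholtzScattering

open Polynomial MeasureTheory

/-! Put γ = k + α. The n-th angular integral expands as ∑_{s>F} ∑_l u_s m_l T(l,s,n) with T(l,s,n) =
∫ P_l P_s P_n. Orthogonality kills T unless l ≥ s - n (`legendreTriple_eq_zero`), and Cauchy–Schwarz
together with |P| ≤ 1 bounds it by 2 s^(-1/2) times either (n+1)^(-1/2) or l^(-1/2). Write the
second factor as l^(-β) (n+1)^(-ε). Summing over l ≥ s - n and then over s > F costs two powers,
which leaves F^(-(γ+4.5)) (n+1)^(-ε) (F+1-n)^(-(γ+β)) (`tsum_mul_legendreTriple_le`).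

The radial kernel is at most a constant times min^n / ((2n+1) max^(n+1)). This is concentrated
within distance of order 1/n of the diagonal, so K_n multiplies a uniform bound on the angular
integral by O(1/(n+1)) (`norm_radialOperator_le`).

What remains is the convolution ∑_{n≤F} (n+1)^(-(1+ε)) (F+1-n)^(-(γ+β)). For k ≥ 1 take ε = 1/2, β =
0: both exponents exceed 1 and the smaller one survives. For k = 0, γ = α may be small, so the half
power goes to l instead (ε = 0, β = 1/2). The exponents are then 1 and α + 1/2, and the harmonic sum
produces the logarithm. -/

theorem natDegree_legendreP_le (n : ℕ) : (legendreP n).natDegree ≤ n := by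
  unfold legendreP
  refine (natDegree_C_mul_le _ _).trans ((natDegree_iterate_derivative _ _).trans ?_)
  have h : ((X ^ 2 - 1 : ℝ[X]) ^ n).natDegree ≤ n * 2 := by
    refine natDegree_pow_le.trans (Nat.mul_le_mul_left _ ?_)
    compute_degree
  omega

/-- In the Leibniz expansion, every term that leaves a factor X - c vanishes at c. -/
theorem eval_iterate_derivative_X_sub_C_pow_mul (n : ℕ) (c : ℝ) (q : ℝ[X]) :
    (derivative^[n] ((X - C c) ^ n * q)).eval c = n.factorial * q.eval c := by
  rw [iterate_derivative_mul, eval_finsetSum, Finset.sum_eq_single 0]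
  · simp [iterate_derivative_X_sub_pow_self]
  · intro k hk hk0
    have hk' : k ≤ n := Nat.lt_succ_iff.mp (Finset.mem_range.mp hk)
    rw [iterate_derivative_X_sub_pow, Nat.sub_sub_self hk']
    simp [hk0]
  · simp

theorem legendreP_eval_one (n : ℕ) : (legendreP n).eval 1 = 1 := by
  have h : (X ^ 2 - 1 : ℝ[X]) ^ n = (X - C 1) ^ n * (X + 1) ^ n := by
    rw [← mul_pow]; congr 1; simp only [map_one]; ring
  rw [legendreP, h, eval_mul, eval_iterate_derivative_X_sub_C_pow_mul]
  have : (n.factorial : ℝ) ≠ 0 := by positivity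
  simp only [eval_C, eval_pow, eval_add, eval_X, eval_one]
  norm_num
  field_simp

theorem legendreP_eval_neg_one_sq (n : ℕ) : (legendreP n).eval (-1) ^ 2 = 1 := by
  have h : (X ^ 2 - 1 : ℝ[X]) ^ n = (X - C (-1)) ^ n * (X - 1) ^ n := by
    rw [← mul_pow]; congr 1; simp only [map_neg, map_one]; ring
  rw [legendreP, h, eval_mul, eval_iterate_derivative_X_sub_C_pow_mul]
  have : (n.factorial : ℝ) ≠ 0 := by positivity
  simp only [eval_C, eval_pow, eval_sub, eval_X, eval_one]
  have h2 : (-1 - 1 : ℝ) ^ n = (-1) ^ n * 2 ^ n := by rw [← mul_pow]; norm_num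
  rw [h2]
  field_simp
  rw [← pow_mul, mul_comm, pow_mul]
  simp

/-- The power w = (X² - 1)^n satisfies (X² - 1) w' = 2n X w; differentiating this n + 1 times gives
Legendre's equation. -/
theorem legendreP_ode (n : ℕ) :
    (X ^ 2 - 1) * derivative^[2] (legendreP n) + 2 * X * derivative (legendreP n)
      = (n * (n + 1) : ℝ[X]) * legendreP n := by
  set w : ℝ[X] := (X ^ 2 - 1) ^ n with hw
  have h1 : (X ^ 2 - 1) * derivative w = 2 * (n : ℝ[X]) * X * w := by
    rcases n with _ | n
    · simp [hw]
    · rw [hw, derivative_pow]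
      simp only [derivative_sub, derivative_X_pow, derivative_one, Nat.add_sub_cancel, map_natCast]
      push_cast
      ring
  have h2 : derivative^[2] w * X ^ 2 - derivative^[2] w
      = (2 * n : ℕ) • w + ((2 * n : ℝ[X]) - 2) * (derivative w * X) := by
    have := congrArg derivative h1
    simp only [derivative_mul, derivative_sub, derivative_X_pow, derivative_one, derivative_X,
      derivative_natCast, derivative_ofNat, map_natCast] at this
    simp only [Function.iterate_succ, Function.iterate_zero, Function.comp_apply, id, nsmul_eq_mul]
    push_cast at this ⊢
    linear_combination this
  have h3 := congrArg (fun p => derivative^[n] p) h2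
  have hc : ((2 * n : ℝ[X]) - 2) = C ((2 * n : ℝ) - 2) := by
    simp only [map_sub, map_mul, map_ofNat, map_natCast]
  simp only [hc, iterate_derivative_sub, iterate_map_add, iterate_derivative_C_mul,
    iterate_derivative_derivative_mul_X_sq,
    iterate_derivative_derivative_mul_X] at h3
  rw [← hc] at h3
  have h4 : derivative^[n] ((2 * n) • w) = (2 * n) • derivative^[n] w :=
    iterate_derivative_smul _ _ _
  have h5 : derivative^[n] (derivative^[2] w) = derivative^[n + 2] w := by
    rw [← Function.iterate_add_apply]
  have h6 : ((n * (n - 1) : ℕ) : ℝ[X]) = n * (n - 1) := by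
    rcases n with _ | n <;> simp
  rw [h4, h5] at h3
  simp only [nsmul_eq_mul, h6] at h3
  have e1 : derivative (legendreP n) = C (1 / (2 ^ n * (n.factorial : ℝ))) *
      derivative^[n + 1] w := by
    rw [legendreP, derivative_C_mul, Function.iterate_succ_apply']
  have e2 : derivative^[2] (legendreP n) = C (1 / (2 ^ n * (n.factorial : ℝ))) *
      derivative^[n + 2] w := by
    rw [Function.iterate_succ_apply', Function.iterate_one, e1, derivative_C_mul,
      ← Function.iterate_succ_apply' derivative (n + 1) w]
  rw [e1, e2, legendreP]
  push_cast at h3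
  linear_combination C (1 / (2 ^ n * (n.factorial : ℝ))) * h3

theorem abs_legendreP_eval_le_one (n : ℕ) {x : ℝ} (hx : x ∈ Set.Icc (-1 : ℝ) 1) :
    |(legendreP n).eval x| ≤ 1 := by
  rcases Nat.eq_zero_or_pos n with rfl | hn
  · simp [legendreP]
  set P := legendreP n
  -- Sonin's function. By Legendre's equation g' = 2x P'², so on [-1, 1] it is largest at the
  -- endpoints, where it equals n(n+1); and it dominates n(n+1) P².
  set g : ℝ[X] := (n * (n + 1) : ℝ[X]) * P ^ 2 + (1 - X ^ 2) * (derivative P) ^ 2 with hg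
  have hg' : derivative g = 2 * X * (derivative P) ^ 2 := by
    have h := legendreP_ode n
    have h' : (derivative^[2]) P = derivative (derivative P) := rfl
    rw [h'] at h
    simp only [hg, derivative_add, derivative_mul, derivative_sub, derivative_X,
      derivative_one, derivative_natCast, derivative_pow, map_natCast]
    push_cast
    linear_combination (-2 * derivative P) * h
  have hN : (0 : ℝ) < n * (n + 1) := by positivity
  have hend : ∀ y : ℝ, y ^ 2 = 1 → P.eval y ^ 2 = 1 → g.eval y = n * (n + 1) := by
    intro y hy hP
    simp [hg, hy, hP]
  have hle : g.eval x ≤ n * (n + 1) := by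
    rcases le_total 0 x with h0 | h0
    · rw [← hend 1 (by norm_num) (by rw [legendreP_eval_one]; norm_num)]
      refine monotoneOn_of_deriv_nonneg (convex_Icc (0 : ℝ) 1) g.continuousOn
        g.differentiableOn ?_ ⟨h0, hx.2⟩ ⟨zero_le_one, le_rfl⟩ hx.2
      intro y hy
      rw [interior_Icc] at hy
      rw [Polynomial.deriv, hg']
      simp only [eval_mul, eval_ofNat, eval_X, eval_pow]
      have := hy.1
      positivity
    · rw [← hend (-1) (by norm_num) (legendreP_eval_neg_one_sq n)]
      refine antitoneOn_of_deriv_nonpos (convex_Icc (-1 : ℝ) 0) g.continuousOn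
        g.differentiableOn ?_ ⟨le_rfl, by norm_num⟩ ⟨hx.1, h0⟩ hx.1
      intro y hy
      rw [interior_Icc] at hy
      rw [Polynomial.deriv, hg']
      simp only [eval_mul, eval_ofNat, eval_X, eval_pow]
      have := hy.2
      have h2 := sq_nonneg (eval y (derivative P))
      nlinarith
  have hx2 : x ^ 2 ≤ 1 := by nlinarith [hx.1, hx.2]
  have hge : (n * (n + 1) : ℝ) * P.eval x ^ 2 ≤ g.eval x := by
    simp only [hg, eval_add, eval_mul, eval_natCast, eval_one, eval_pow, eval_sub, eval_X]
    nlinarith [mul_nonneg (sub_nonneg.2 hx2) (sq_nonneg (eval x (derivative P)))]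
  rw [← sq_le_one_iff_abs_le_one]
  by_contra! hcon
  nlinarith

theorem intervalIntegrable_eval (p : ℝ[X]) (a b : ℝ) :
    IntervalIntegrable (fun x => p.eval x) volume a b :=
  p.continuous.intervalIntegrable a b

theorem integral_derivative_mul (p q : ℝ[X]) (a b : ℝ) :
    ∫ x in a..b, (derivative p).eval x * q.eval x
      = p.eval b * q.eval b - p.eval a * q.eval a
        - ∫ x in a..b, p.eval x * (derivative q).eval x := by
  rw [eq_sub_iff_add_eq, ← intervalIntegral.integral_add
    (Continuous.intervalIntegrable (by fun_prop) a b)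
    (Continuous.intervalIntegrable (by fun_prop) a b)]
  rw [← intervalIntegral.integral_deriv_mul_eq_sub (fun x _ => p.hasDerivAt x)
    (fun x _ => q.hasDerivAt x) (intervalIntegrable_eval _ _ _) (intervalIntegrable_eval _ _ _)]

/-- Integrate by parts j times: fewer than n derivatives of w leave a factor X² - 1, so all boundary
terms vanish. -/
theorem integral_iterate_derivative_mul_eq_zero {n : ℕ} {w : ℝ[X]} (hw : (X ^ 2 - 1) ^ n ∣ w) :
    ∀ j ≤ n, ∀ q : ℝ[X], derivative^[j] q = 0 →
      ∫ x in (-1 : ℝ)..1, (derivative^[j] w).eval x * q.eval x = 0 := by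
  intro j
  induction j with
  | zero => intro _ q hq; simp_all
  | succ j ih =>
    intro hj q hq
    have hroot : ∀ y : ℝ, y ^ 2 = 1 → (derivative^[j] w).eval y = 0 := by
      intro y hy
      have hd : (X ^ 2 - 1 : ℝ[X]) ∣ derivative^[j] w :=
        (dvd_pow_self _ (by omega)).trans (pow_sub_dvd_iterate_derivative_of_pow_dvd j hw)
      obtain ⟨r, hr⟩ := hd
      rw [hr]
      simp [hy]
    rw [Function.iterate_succ_apply', integral_derivative_mul, hroot 1 (by norm_num),
      hroot (-1) (by norm_num), ih (by omega) (derivative q) hq]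
    simp

theorem integral_legendreP_mul_eq_zero {n : ℕ} {q : ℝ[X]} (hq : derivative^[n] q = 0) :
    ∫ x in (-1 : ℝ)..1, (legendreP n).eval x * q.eval x = 0 := by
  have h := integral_iterate_derivative_mul_eq_zero (n := n) dvd_rfl n le_rfl q hq
  simp only [legendreP, eval_mul, eval_C, mul_assoc]
  rw [intervalIntegral.integral_const_mul, h, mul_zero]

/-- The leading terms of X P' and n P cancel, so X P' - n P is orthogonal to P and ∫ x P P' = n ∫
P². Integrating P' · (x P) by parts gives 2 ∫ x P P' + ∫ P² = 2. -/
theorem integral_legendreP_sq (n : ℕ) :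
    ∫ x in (-1 : ℝ)..1, (legendreP n).eval x ^ 2 = 2 / (2 * n + 1) := by
  set P := legendreP n
  have hdeg : derivative^[n] (derivative P * X - (n : ℝ[X]) * P) = 0 := by
    rw [iterate_derivative_sub, iterate_derivative_derivative_mul_X,
      iterate_derivative_natCast_mul, iterate_derivative_eq_zero (p := P) (x := n + 1)
        (Nat.lt_succ_of_le (natDegree_legendreP_le n))]
    simp
  have h1 := integral_legendreP_mul_eq_zero hdeg
  have h2 := integral_derivative_mul P (P * X) (-1) 1
  have hI : ∀ p : ℝ[X], IntervalIntegrable (fun x => p.eval x) volume (-1) 1 :=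
    fun p => intervalIntegrable_eval _ _ _
  have e1 : ∫ x in (-1 : ℝ)..1, P.eval x * (derivative P * X - (n : ℝ[X]) * P).eval x
      = (∫ x in (-1 : ℝ)..1, (P * derivative P * X).eval x)
        - n * ∫ x in (-1 : ℝ)..1, P.eval x ^ 2 := by
    rw [← intervalIntegral.integral_const_mul, ← intervalIntegral.integral_sub (hI _)]
    · congr 1; ext x; simp; ring
    · exact Continuous.intervalIntegrable (by fun_prop) _ _
  have e2 : ∫ x in (-1 : ℝ)..1, (derivative P).eval x * (P * X).eval x
      = ∫ x in (-1 : ℝ)..1, (P * derivative P * X).eval x := by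
    congr 1; ext x; simp; ring
  have e3 : ∫ x in (-1 : ℝ)..1, P.eval x * (derivative (P * X)).eval x
      = (∫ x in (-1 : ℝ)..1, (P * derivative P * X).eval x)
        + ∫ x in (-1 : ℝ)..1, P.eval x ^ 2 := by
    rw [← intervalIntegral.integral_add (hI _)]
    · congr 1; ext x; simp; ring
    · exact Continuous.intervalIntegrable (by fun_prop) _ _
  have v1 : P.eval 1 = 1 := legendreP_eval_one n
  have v2 : P.eval (-1) ^ 2 = 1 := legendreP_eval_neg_one_sq n
  rw [e1] at h1
  rw [e2, e3] at h2
  rw [eval_mul, eval_mul, eval_X, eval_X, v1] at h2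
  rw [eq_div_iff (by positivity)]
  linear_combination (-2 : ℝ) * h1 + h2 + v2

/-- The integral `∫₋₁¹ Pₗ Pₛ Pₙ` of a product of three Legendre polynomials. -/
noncomputable def legendreTriple (l s n : ℕ) : ℝ :=
  ∫ x in (-1 : ℝ)..1, (legendreP l).eval x * (legendreP s).eval x * (legendreP n).eval x

theorem legendreTriple_eq_zero {l s n : ℕ} (h : l + n < s) : legendreTriple l s n = 0 := by
  have hq : derivative^[s] (legendreP l * legendreP n) = 0 := by
    refine iterate_derivative_eq_zero (natDegree_mul_le.trans_lt ?_)
    have h1 := natDegree_legendreP_le l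
    have h2 := natDegree_legendreP_le n
    omega
  rw [← integral_legendreP_mul_eq_zero hq, legendreTriple]
  congr 1; ext x
  rw [eval_mul]; ring

/-- Cauchy–Schwarz, in the form of a weighted AM–GM inequality whose weights t/r and r/t make the
two squared norms contribute equally. -/
theorem abs_integral_legendreP_mul_le (a b : ℕ) {f : ℝ → ℝ}
    (hf : ∀ x ∈ Set.Icc (-1 : ℝ) 1, |f x| ≤ 1) :
    |∫ x in (-1 : ℝ)..1, (legendreP a).eval x * (legendreP b).eval x * f x|
      ≤ 2 / (√(2 * a + 1) * √(2 * b + 1)) := by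
  set t : ℝ := √(2 * a + 1) with ht
  set r : ℝ := √(2 * b + 1) with hr
  have ht0 : 0 < t := Real.sqrt_pos.2 (by positivity)
  have hr0 : 0 < r := Real.sqrt_pos.2 (by positivity)
  have ht2 : t ^ 2 = 2 * a + 1 := Real.sq_sqrt (by positivity)
  have hr2 : r ^ 2 = 2 * b + 1 := Real.sq_sqrt (by positivity)
  have hIa : IntervalIntegrable (fun x => (t / (2 * r)) * (legendreP a).eval x ^ 2)
      volume (-1) 1 :=
    Continuous.intervalIntegrable (by fun_prop) _ _
  have hIb : IntervalIntegrable (fun x => (r / (2 * t)) * (legendreP b).eval x ^ 2)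
      volume (-1) 1 :=
    Continuous.intervalIntegrable (by fun_prop) _ _
  have hb : ∀ x ∈ Set.Ioc (-1 : ℝ) 1,
      ‖(legendreP a).eval x * (legendreP b).eval x * f x‖
        ≤ (t / (2 * r)) * (legendreP a).eval x ^ 2
          + (r / (2 * t)) * (legendreP b).eval x ^ 2 := by
    intro x hx
    set p := (legendreP a).eval x
    set q := (legendreP b).eval x
    have h1 : ‖p * q * f x‖ ≤ |p| * |q| := by
      rw [Real.norm_eq_abs, abs_mul, abs_mul]
      exact mul_le_of_le_one_right (by positivity) (hf x ⟨hx.1.le, hx.2⟩)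
    refine h1.trans ?_
    have h2 : (t / (2 * r)) * p ^ 2 + (r / (2 * t)) * q ^ 2 - |p| * |q|
        = (t * |p| - r * |q|) ^ 2 / (2 * r * t) := by
      rw [← sq_abs p, ← sq_abs q]
      field_simp
      ring
    have h3 : 0 ≤ (t * |p| - r * |q|) ^ 2 / (2 * r * t) := by positivity
    linarith
  have h := intervalIntegral.norm_integral_le_of_norm_le (by norm_num : (-1 : ℝ) ≤ 1)
    (Filter.Eventually.of_forall hb) (hIa.add hIb)
  rw [intervalIntegral.integral_add hIa hIb, intervalIntegral.integral_const_mul,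
    intervalIntegral.integral_const_mul, integral_legendreP_sq, integral_legendreP_sq,
    ← ht2, ← hr2, Real.norm_eq_abs] at h
  refine h.trans (le_of_eq ?_)
  field_simp
  norm_num

end HelmholtzScattering

/-! ### Spherical Bessel functions and the Green kernel. -/

namespace HelmholtzScattering

/-- The series `∑ z^q / (q! ν(ν+2)⋯(ν+2q-2))` underlying the spherical Bessel functions. -/
noncomputable def besselSeries (ν z : ℝ) : ℝ :=
  ∑' q : ℕ, z ^ q / ((q.factorial : ℝ) * ∏ i ∈ Finset.range q, (ν + 2 * (i : ℝ)))

theorem one_le_abs_prod {ν : ℝ} (hν : ∀ i : ℕ, 1 ≤ |ν + 2 * (i : ℝ)|) (q : ℕ) :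
    1 ≤ |∏ i ∈ Finset.range q, (ν + 2 * (i : ℝ))| := by
  rw [Finset.abs_prod]
  exact Finset.prod_induction _ (1 ≤ ·) (fun a b => one_le_mul_of_one_le_of_one_le) le_rfl
    fun i _ => hν i

theorem norm_besselSeries_term_le {ν : ℝ} (hν : ∀ i : ℕ, 1 ≤ |ν + 2 * (i : ℝ)|) (z : ℝ) (q : ℕ) :
    ‖z ^ q / ((q.factorial : ℝ) * ∏ i ∈ Finset.range q, (ν + 2 * (i : ℝ)))‖
      ≤ |z| ^ q / (q.factorial : ℝ) := by
  rw [norm_div, norm_mul, norm_pow, Real.norm_eq_abs, Real.norm_eq_abs, Real.norm_eq_abs,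
    Nat.abs_cast]
  have h := one_le_abs_prod hν q
  gcongr
  exact le_mul_of_one_le_right (by positivity) h

theorem summable_besselSeries {ν : ℝ} (hν : ∀ i : ℕ, 1 ≤ |ν + 2 * (i : ℝ)|) (z : ℝ) :
    Summable fun q : ℕ =>
      z ^ q / ((q.factorial : ℝ) * ∏ i ∈ Finset.range q, (ν + 2 * (i : ℝ))) :=
  Summable.of_norm_bounded (Real.summable_pow_div_factorial |z|) (norm_besselSeries_term_le hν z)

theorem abs_besselSeries_le {ν : ℝ} (hν : ∀ i : ℕ, 1 ≤ |ν + 2 * (i : ℝ)|) (z : ℝ) :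
    |besselSeries ν z| ≤ Real.exp |z| := by
  have h := tsum_of_norm_bounded (NormedSpace.expSeries_div_hasSum_exp |z|)
    (norm_besselSeries_term_le hν z)
  rwa [← Real.exp_eq_exp_ℝ] at h

/-- Source of the three-term recurrences for j_n and y_n. The constant terms cancel, and the
coefficient of z^(q+1) on the left matches that of z^q in the shifted series. The hypothesis, true
for odd integers ν, keeps the denominators nonzero. -/
theorem besselSeries_sub {ν : ℝ} (hν : ∀ i : ℕ, 1 ≤ |ν + 2 * (i : ℝ)|) (z : ℝ) :
    besselSeries ν z - besselSeries (ν + 2) z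
      = 2 * z / (ν * (ν + 2)) * besselSeries (ν + 4) z := by
  have hν2 : ∀ i : ℕ, 1 ≤ |ν + 2 + 2 * (i : ℝ)| := fun i => by
    have := hν (i + 1); push_cast at this; convert this using 2; ring
  have hν4 : ∀ i : ℕ, 1 ≤ |ν + 4 + 2 * (i : ℝ)| := fun i => by
    have := hν (i + 2); push_cast at this; convert this using 2; ring
  have ne : ∀ {x : ℝ}, 1 ≤ |x| → x ≠ 0 := fun h => abs_pos.1 (zero_lt_one.trans_le h)
  have h0 : ν ≠ 0 := by simpa using ne (hν 0)
  have h2 : ν + 2 ≠ 0 := by simpa using ne (hν2 0)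
  unfold besselSeries
  rw [← (summable_besselSeries hν z).tsum_sub (summable_besselSeries hν2 z),
    ((summable_besselSeries hν z).sub (summable_besselSeries hν2 z)).tsum_eq_zero_add,
    ← tsum_mul_left]
  simp only [Finset.range_zero, Finset.prod_empty, sub_self, zero_add]
  refine tsum_congr fun q => ?_
  set p := ∏ i ∈ Finset.range q, (ν + 4 + 2 * (i : ℝ)) with hp
  set p1 := ∏ i ∈ Finset.range q, (ν + 2 + 2 * (i : ℝ)) with hp1
  have hp0 : p ≠ 0 := ne (one_le_abs_prod hν4 q)
  have hp10 : p1 ≠ 0 := ne (one_le_abs_prod hν2 q)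
  have e1 : ∏ i ∈ Finset.range (q + 1), (ν + 2 * (i : ℝ)) = ν * p1 := by
    rw [Finset.prod_range_succ', mul_comm]
    congr 1
    · simp
    · exact Finset.prod_congr rfl fun i _ => by push_cast; ring
  have e2 : ∏ i ∈ Finset.range (q + 1), (ν + 2 + 2 * (i : ℝ)) = (ν + 2) * p := by
    rw [Finset.prod_range_succ', mul_comm]
    congr 1
    · simp
    · exact Finset.prod_congr rfl fun i _ => by push_cast; ring
  have e3 : p1 * (ν + 2 + 2 * q) = (ν + 2) * p := by
    rw [← e2, Finset.prod_range_succ]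
  have hq : ν + 2 + 2 * (q : ℝ) ≠ 0 := ne (hν2 q)
  have hp1' : p1 = (ν + 2) * p / (ν + 2 + 2 * q) := by rw [eq_div_iff hq, e3]
  rw [e1, e2, hp1', Nat.factorial_succ]
  push_cast
  have : (q.factorial : ℝ) ≠ 0 := by positivity
  have : (q : ℝ) + 1 ≠ 0 := by positivity
  field_simp
  ring

theorem one_le_abs_of_odd (a : ℤ) (ha : Odd a) {x : ℝ} (hx : x = a) : 1 ≤ |x| := by
  rw [hx, ← Int.cast_abs]
  exact_mod_cast Int.one_le_abs (by rintro rfl; simp at ha)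

theorem one_le_abs_one_sub (n : ℕ) (i : ℕ) : 1 ≤ |(1 - 2 * (n : ℝ)) + 2 * (i : ℝ)| :=
  one_le_abs_of_odd (2 * (i - n) + 1) ⟨_, rfl⟩ (by push_cast; ring)

theorem one_le_abs_add_three (n : ℕ) (i : ℕ) : 1 ≤ |(2 * (n : ℝ) + 3) + 2 * (i : ℝ)| :=
  one_le_abs_of_odd (2 * (n + 1 + i) + 1) ⟨_, rfl⟩ (by push_cast; ring)

theorem besselSeries_one (x : ℝ) : besselSeries 1 (-(x ^ 2 / 2)) = Real.cos x := by
  rw [← (Real.hasSum_cos x).tsum_eq]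
  refine tsum_congr fun q => ?_
  have h : ∀ q : ℕ, 2 ^ q * ((q.factorial : ℝ) * ∏ i ∈ Finset.range q, (1 + 2 * (i : ℝ)))
      = (2 * q).factorial := by
    intro q
    induction q with
    | zero => simp
    | succ q ih =>
      rw [Finset.prod_range_succ, Nat.factorial_succ, show 2 * (q + 1) = 2 * q + 1 + 1 by ring,
        Nat.factorial_succ, Nat.factorial_succ]
      push_cast
      rw [← ih]
      ring
  rw [← h q, neg_pow, div_pow, pow_mul]
  have : (∏ i ∈ Finset.range q, (1 + 2 * (i : ℝ))) ≠ 0 := by positivity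
  field_simp

theorem mul_besselSeries_three (x : ℝ) : x * besselSeries 3 (-(x ^ 2 / 2)) = Real.sin x := by
  rw [← (Real.hasSum_sin x).tsum_eq, besselSeries, ← tsum_mul_left]
  refine tsum_congr fun q => ?_
  have h : ∀ q : ℕ, 2 ^ q * ((q.factorial : ℝ) * ∏ i ∈ Finset.range q, (3 + 2 * (i : ℝ)))
      = (2 * q + 1).factorial := by
    intro q
    induction q with
    | zero => simp
    | succ q ih =>
      rw [Finset.prod_range_succ, Nat.factorial_succ,
        show 2 * (q + 1) + 1 = 2 * q + 1 + 1 + 1 by ring,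
        Nat.factorial_succ (2 * q + 1 + 1), Nat.factorial_succ (2 * q + 1)]
      push_cast
      rw [← ih]
      ring
  rw [← h q, neg_pow, div_pow, pow_succ x (2 * q), pow_mul x 2 q]
  have : (∏ i ∈ Finset.range q, (3 + 2 * (i : ℝ))) ≠ 0 := by positivity
  field_simp

/-- The odd double factorial `1·3·5⋯(2n-1)` as a real number. -/
noncomputable def oddProd (n : ℕ) : ℝ := ∏ i ∈ Finset.range n, (2 * (i : ℝ) + 1)

theorem oddProd_pos (n : ℕ) : 0 < oddProd n := Finset.prod_pos fun _ _ => by positivity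

theorem oddProd_succ (n : ℕ) : oddProd (n + 1) = oddProd n * (2 * n + 1) :=
  Finset.prod_range_succ _ _

theorem sphericalJ_eq (n : ℕ) (x : ℝ) :
    sphericalJ n x = x ^ n / oddProd (n + 1) * besselSeries (2 * n + 3) (-(x ^ 2 / 2)) := rfl

theorem sphericalY_eq (n : ℕ) (x : ℝ) :
    sphericalY n x
      = -(oddProd n / x ^ (n + 1)) * besselSeries (1 - 2 * n) (-(x ^ 2 / 2)) := by
  rw [sphericalY, besselSeries, oddProd]
  congr 1
  refine tsum_congr fun q => ?_
  congr 2
  exact Finset.prod_congr rfl fun i _ => by ring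

theorem sphericalJ_add_two (n : ℕ) {x : ℝ} (hx : 0 < x) :
    sphericalJ (n + 2) x = (2 * n + 3) / x * sphericalJ (n + 1) x - sphericalJ n x := by
  have h := besselSeries_sub (one_le_abs_add_three n) (-(x ^ 2 / 2))
  rw [sphericalJ_eq, sphericalJ_eq, sphericalJ_eq, oddProd_succ (n + 2), oddProd_succ (n + 1)]
  push_cast
  rw [show 2 * ((n : ℝ) + 2) + 3 = 2 * n + 3 + 4 by ring,
    show 2 * ((n : ℝ) + 1) + 3 = 2 * n + 3 + 2 by ring]
  rw [sub_eq_iff_eq_add] at h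
  rw [h]
  have := (oddProd_pos (n + 1)).ne'
  have h1 : 2 * (n : ℝ) + 3 ≠ 0 := by positivity
  have h2 : 2 * (n : ℝ) + 3 + 2 ≠ 0 := by positivity
  have h3 : 2 * ((n : ℝ) + 1) + 1 ≠ 0 := by positivity
  have h4 : 2 * ((n : ℝ) + 2) + 1 ≠ 0 := by positivity
  field_simp
  ring

theorem sphericalY_add_two (n : ℕ) {x : ℝ} (hx : 0 < x) :
    sphericalY (n + 2) x = (2 * n + 3) / x * sphericalY (n + 1) x - sphericalY n x := by
  have h := besselSeries_sub (one_le_abs_one_sub (n + 2)) (-(x ^ 2 / 2))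
  rw [sphericalY_eq, sphericalY_eq, sphericalY_eq, oddProd_succ (n + 1), oddProd_succ n]
  push_cast at h ⊢
  rw [show 1 - 2 * ((n : ℝ) + 2) + 2 = 1 - 2 * (n + 1) by ring,
    show 1 - 2 * ((n : ℝ) + 2) + 4 = 1 - 2 * n by ring, sub_eq_iff_eq_add] at h
  rw [h, show 1 - 2 * ((n : ℝ) + 2) = -(2 * n + 3) by ring,
    show 1 - 2 * ((n : ℝ) + 1) = -(2 * n + 1) by ring]
  have := (oddProd_pos n).ne'
  have h1 : 2 * (n : ℝ) + 3 ≠ 0 := by positivity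
  have h2 : 2 * (n : ℝ) + 1 ≠ 0 := by positivity
  field_simp
  ring

theorem sphericalJ_zero {x : ℝ} (hx : 0 < x) : sphericalJ 0 x = Real.sin x / x := by
  rw [← mul_besselSeries_three, sphericalJ_eq]
  simp [oddProd]
  field_simp

theorem sphericalY_zero (x : ℝ) : sphericalY 0 x = -(Real.cos x / x) := by
  rw [← besselSeries_one, sphericalY_eq]
  simp [oddProd]
  ring

theorem sphericalJ_one {x : ℝ} (hx : 0 < x) :
    sphericalJ 1 x = Real.sin x / x ^ 2 - Real.cos x / x := by
  have h := besselSeries_sub (ν := 1)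
    (fun i => by simpa using one_le_abs_one_sub 0 i) (-(x ^ 2 / 2))
  rw [besselSeries_one, sub_eq_iff_eq_add] at h
  rw [h, ← mul_besselSeries_three, sphericalJ_eq]
  norm_num [oddProd, Finset.prod_range_succ]
  field_simp
  ring

theorem sphericalY_one {x : ℝ} (hx : 0 < x) :
    sphericalY 1 x = -(Real.cos x / x ^ 2) - Real.sin x / x := by
  have h := besselSeries_sub (ν := -1)
    (fun i => by simpa using (one_le_abs_one_sub 1 i).trans_eq (by norm_num)) (-(x ^ 2 / 2))
  norm_num at h
  rw [besselSeries_one, sub_eq_iff_eq_add] at h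
  rw [← mul_besselSeries_three, sphericalY_eq]
  norm_num [oddProd, Finset.prod_range_succ]
  rw [h]
  field_simp
  ring

/-- The Bessel-polynomial majorant of `|jₙ(x)|` and `|yₙ(x)|`. -/
noncomputable def besselMajorant : ℕ → ℝ → ℝ
  | 0, x => 1 / x
  | 1, x => 1 / x + 1 / x ^ 2
  | n + 2, x => (2 * n + 3) / x * besselMajorant (n + 1) x + besselMajorant n x

theorem besselMajorant_add_two (n : ℕ) (x : ℝ) : besselMajorant (n + 2) x
    = (2 * n + 3) / x * besselMajorant (n + 1) x + besselMajorant n x := rfl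

theorem besselMajorant_nonneg (n : ℕ) {x : ℝ} (hx : 0 < x) : 0 ≤ besselMajorant n x := by
  induction n using Nat.twoStepInduction with
  | zero => simp only [besselMajorant]; positivity
  | one => simp only [besselMajorant]; positivity
  | more n h1 h2 => rw [besselMajorant_add_two]; positivity

/-- Monotonicity is what the oscillating j_n and y_n lack; it allows a large argument to be replaced
by a bounded one. -/
theorem besselMajorant_antitone (n : ℕ) {x y : ℝ} (hx : 0 < x) (hxy : x ≤ y) :
    besselMajorant n y ≤ besselMajorant n x := by
  have hy : 0 < y := hx.trans_le hxy
  induction n using Nat.twoStepInduction with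
  | zero => simp only [besselMajorant]; gcongr
  | one => simp only [besselMajorant]; gcongr
  | more n h1 h2 =>
    rw [besselMajorant_add_two, besselMajorant_add_two]
    have := besselMajorant_nonneg (n + 1) hx
    have := besselMajorant_nonneg (n + 1) hy
    gcongr

theorem pow_mul_besselMajorant_le (n : ℕ) {x : ℝ} (hx : 0 < x) :
    x ^ (n + 1) * besselMajorant n x ≤ (1 + x) * Real.exp (x ^ 2) * oddProd n := by
  -- Two consecutive indices are carried along for the recurrence. Each step costs a factor 1 +
  -- x²/((2n+1)(2n+3)), absorbed by the exponential because 2/((2n+1)(2n+3)) = 1/(2n+1) - 1/(2n+3)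
  -- telescopes.
  have key : ∀ n : ℕ,
      x ^ (n + 1) * besselMajorant n x
        ≤ (1 + x) * Real.exp (x ^ 2 * (1 - 1 / (2 * n + 1))) * oddProd n ∧
      x ^ (n + 2) * besselMajorant (n + 1) x
        ≤ (1 + x) * Real.exp (x ^ 2 * (1 - 1 / (2 * n + 1))) * oddProd (n + 1) := by
    intro n
    induction n with
    | zero =>
      simp only [besselMajorant, oddProd]
      norm_num
      constructor
      · rw [mul_inv_cancel₀ hx.ne']; linarith
      · apply le_of_eq; field_simp; ring
    | succ n ih =>
      obtain ⟨h1, h2⟩ := ih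
      set E := Real.exp (x ^ 2 * (1 - 1 / (2 * n + 1))) with hE
      set E' := Real.exp (x ^ 2 * (1 - 1 / (2 * ((n + 1 : ℕ) : ℝ) + 1))) with hE'
      have hEE : E * (1 + x ^ 2 / ((2 * n + 1) * (2 * n + 3))) ≤ E' := by
        have hs : x ^ 2 * (1 - 1 / (2 * ((n + 1 : ℕ) : ℝ) + 1))
            = x ^ 2 * (1 - 1 / (2 * n + 1)) + 2 * (x ^ 2 / ((2 * n + 1) * (2 * n + 3))) := by
          push_cast
          field_simp
          ring
        rw [hE', hs, Real.exp_add]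
        gcongr
        have h3 := Real.add_one_le_exp (2 * (x ^ 2 / ((2 * (n : ℝ) + 1) * (2 * n + 3))))
        have h4 : 0 ≤ x ^ 2 / ((2 * (n : ℝ) + 1) * (2 * n + 3)) := by positivity
        linarith
      have hEpos : 0 < E := Real.exp_pos _
      have hEle : E ≤ E' := by
        refine le_trans ?_ hEE
        exact le_mul_of_one_le_right hEpos.le (by
          have : 0 ≤ x ^ 2 / ((2 * (n : ℝ) + 1) * (2 * n + 3)) := by positivity
          linarith)
      have hD := oddProd_pos n
      have hD1 := oddProd_pos (n + 1)
      refine ⟨h2.trans (by gcongr), ?_⟩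
      rw [show n + 1 + 1 = n + 2 by ring, besselMajorant_add_two]
      calc x ^ (n + 1 + 2) * ((2 * n + 3) / x * besselMajorant (n + 1) x + besselMajorant n x)
          = (2 * n + 3) * (x ^ (n + 2) * besselMajorant (n + 1) x)
            + x ^ 2 * (x ^ (n + 1) * besselMajorant n x) := by field_simp; ring
        _ ≤ (2 * n + 3) * ((1 + x) * E * oddProd (n + 1))
            + x ^ 2 * ((1 + x) * E * oddProd n) := by gcongr
        _ = (1 + x) * (E * (1 + x ^ 2 / ((2 * n + 1) * (2 * n + 3)))) * oddProd (n + 2) := by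
            rw [oddProd_succ (n + 1), oddProd_succ n]
            push_cast
            field_simp
            ring
        _ ≤ (1 + x) * E' * oddProd (n + 2) := by
            have := oddProd_pos (n + 2)
            gcongr
  refine (key n).1.trans ?_
  have := oddProd_pos n
  gcongr
  have : (0 : ℝ) ≤ 1 / (2 * n + 1) := by positivity
  nlinarith [sq_nonneg x]

theorem abs_le_besselMajorant {x : ℝ} (hx : 0 < x) {f : ℕ → ℝ}
    (hf : ∀ n : ℕ, f (n + 2) = (2 * n + 3) / x * f (n + 1) - f n)
    (h0 : |f 0| ≤ 1 / x) (h1 : |f 1| ≤ 1 / x + 1 / x ^ 2) (n : ℕ) :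
    |f n| ≤ besselMajorant n x := by
  induction n using Nat.twoStepInduction with
  | zero => exact h0
  | one => exact h1
  | more n ih1 ih2 =>
    rw [hf, besselMajorant_add_two]
    refine (abs_sub _ _).trans ?_
    rw [abs_mul, abs_of_nonneg (by positivity : 0 ≤ (2 * (n : ℝ) + 3) / x)]
    gcongr

theorem abs_sphericalJ_le_besselMajorant (n : ℕ) {x : ℝ} (hx : 0 < x) :
    |sphericalJ n x| ≤ besselMajorant n x := by
  refine abs_le_besselMajorant (f := fun n => sphericalJ n x) hx
    (fun n => sphericalJ_add_two n hx) ?_ ?_ n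
  · rw [sphericalJ_zero hx, abs_div, abs_of_pos hx]
    gcongr
    exact Real.abs_sin_le_one x
  · rw [sphericalJ_one hx]
    refine (abs_sub _ _).trans ?_
    rw [abs_div, abs_div, abs_of_pos hx, abs_of_pos (by positivity : 0 < x ^ 2), add_comm]
    gcongr
    · exact Real.abs_cos_le_one x
    · exact Real.abs_sin_le_one x

theorem abs_sphericalY_le_besselMajorant (n : ℕ) {x : ℝ} (hx : 0 < x) :
    |sphericalY n x| ≤ besselMajorant n x := by
  refine abs_le_besselMajorant (f := fun n => sphericalY n x) hx
    (fun n => sphericalY_add_two n hx) ?_ ?_ n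
  · rw [sphericalY_zero, abs_neg, abs_div, abs_of_pos hx]
    gcongr
    exact Real.abs_cos_le_one x
  · rw [sphericalY_one hx]
    refine (abs_sub _ _).trans ?_
    rw [abs_neg, abs_div, abs_div, abs_of_pos hx, abs_of_pos (by positivity : 0 < x ^ 2),
      add_comm]
    gcongr
    · exact Real.abs_sin_le_one x
    · exact Real.abs_cos_le_one x

theorem norm_sphericalH_le (n : ℕ) {x : ℝ} (hx : 0 < x) :
    ‖sphericalH n x‖ ≤ 2 * besselMajorant n x := by
  refine (norm_add_le _ _).trans ?_
  rw [norm_mul, Complex.norm_I, one_mul, Complex.norm_real, Complex.norm_real, two_mul]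
  exact add_le_add (abs_sphericalJ_le_besselMajorant n hx) (abs_sphericalY_le_besselMajorant n hx)

/-- Read off from the power series: the majorant blows up at 0, whereas the kernel needs the decay
x^n. -/
theorem abs_sphericalJ_le (n : ℕ) {x : ℝ} (hx : 0 ≤ x) :
    |sphericalJ n x| ≤ x ^ n / oddProd (n + 1) * Real.exp (x ^ 2) := by
  have h := abs_besselSeries_le (one_le_abs_add_three n) (-(x ^ 2 / 2))
  have := oddProd_pos (n + 1)
  rw [sphericalJ_eq, abs_mul, abs_of_nonneg (by positivity : 0 ≤ x ^ n / oddProd (n + 1))]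
  gcongr
  refine h.trans (Real.exp_le_exp.2 ?_)
  rw [abs_neg, abs_of_nonneg (by positivity)]
  nlinarith [sq_nonneg x]

/-- Pointwise bound for the Green kernel: `a` may be arbitrarily large, and only `min a R`
enters. -/
theorem norm_sphericalH_mul_sphericalJ_le {κ R : ℝ} (hκ : 0 < κ) (n : ℕ) {a ρ : ℝ} (ha : 0 ≤ a)
    (hρ : 0 < ρ) (hρR : ρ ≤ R) :
    ‖sphericalH n (κ * max a ρ) * (sphericalJ n (κ * min a ρ) : ℂ)‖
      ≤ 2 * (1 + κ * R) * Real.exp ((κ * R) ^ 2) ^ 2 / (κ * (2 * n + 1)) *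
        (min (min a R) ρ ^ n / max (min a R) ρ ^ (n + 1)) := by
  set M := max (min a R) ρ with hM
  have hM0 : 0 < M := hρ.trans_le (le_max_right _ _)
  have hMle : M ≤ max a ρ := max_le_max (min_le_left _ _) le_rfl
  have hMR : M ≤ R := max_le (min_le_right _ _) hρR
  have hmin : min (min a R) ρ = min a ρ := by rw [min_assoc, min_eq_right hρR]
  have hμ0 : 0 ≤ min a ρ := le_min ha hρ.le
  have hμR : min a ρ ≤ R := (min_le_right _ _).trans hρR
  have hR : 0 < R := hρ.trans_le hρR
  have hD := oddProd_pos n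
  -- Antitonicity moves the argument from κ max(a, ρ), which is unbounded in a, down to κM ≤ κR.
  have h1 : ‖sphericalH n (κ * max a ρ)‖
      ≤ 2 * ((1 + κ * R) * Real.exp ((κ * R) ^ 2) * oddProd n / (κ * M) ^ (n + 1)) := by
    refine (norm_sphericalH_le n (mul_pos hκ (hM0.trans_le hMle))).trans ?_
    gcongr
    refine (besselMajorant_antitone n (mul_pos hκ hM0)
      (mul_le_mul_of_nonneg_left hMle hκ.le)).trans ?_
    rw [le_div_iff₀ (by positivity), mul_comm]
    refine (pow_mul_besselMajorant_le n (mul_pos hκ hM0)).trans ?_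
    gcongr
  have h2 : ‖(sphericalJ n (κ * min a ρ) : ℂ)‖
      ≤ (κ * min a ρ) ^ n / oddProd (n + 1) * Real.exp ((κ * R) ^ 2) := by
    rw [Complex.norm_real, Real.norm_eq_abs]
    refine (abs_sphericalJ_le n (by positivity)).trans ?_
    have := oddProd_pos (n + 1)
    gcongr
  rw [norm_mul]
  refine (mul_le_mul h1 h2 (norm_nonneg _) (by positivity)).trans (le_of_eq ?_)
  -- The quotient of odd products is 1/(2n+1), which later cancels the factor 2n+1 in Kₙ.
  rw [hmin, oddProd_succ]
  field_simp
  rw [mul_pow, mul_pow]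
  ring

end HelmholtzScattering

/-! ### The radial integral gains a factor 1/(n+1). -/

namespace HelmholtzScattering

open MeasureTheory

/-- Since max ≤ R, min/max = 1 - |ρ - b|/max ≤ 1 - |ρ - b|/R; the leftover factor ρ²/max is at most
R. -/
theorem sq_mul_min_pow_div_max_pow_le {R b ρ : ℝ} (hb : 0 ≤ b) (hbR : b ≤ R) (hρ : 0 < ρ)
    (hρR : ρ ≤ R) (n : ℕ) :
    ρ ^ 2 * (min b ρ ^ n / max b ρ ^ (n + 1)) ≤ R * (1 - |ρ - b| / R) ^ n := by
  have hR : 0 < R := hρ.trans_le hρR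
  have hM : 0 < max b ρ := hρ.trans_le (le_max_right _ _)
  have hMR : max b ρ ≤ R := max_le hbR hρR
  have hμ : 0 ≤ min b ρ := le_min hb hρ.le
  have hdiff : min b ρ = max b ρ - |ρ - b| := by
    have := max_sub_min_eq_abs b ρ
    linarith
  have h1 : min b ρ / max b ρ ≤ 1 - |ρ - b| / R := by
    rw [hdiff, sub_div, div_self hM.ne']
    gcongr
  have h2 : ρ ^ 2 / max b ρ ≤ R := by
    rw [div_le_iff₀ hM, sq]
    exact mul_le_mul hρR (le_max_right _ _) hρ.le hR.le
  calc ρ ^ 2 * (min b ρ ^ n / max b ρ ^ (n + 1))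
      = (ρ ^ 2 / max b ρ) * (min b ρ / max b ρ) ^ n := by
        rw [div_pow]; field_simp; ring
    _ ≤ R * (1 - |ρ - b| / R) ^ n := by gcongr

theorem integral_one_sub_abs_pow_le {R b : ℝ} (hR : 0 < R) (hb : 0 ≤ b) (hbR : b ≤ R) (n : ℕ) :
    ∫ ρ in (0 : ℝ)..R, (1 - |ρ - b| / R) ^ n ≤ 2 * R / (n + 1) := by
  have hc : Continuous fun ρ : ℝ => (1 - |ρ - b| / R) ^ n := by fun_prop
  rw [← intervalIntegral.integral_add_adjacent_intervals (hc.intervalIntegrable 0 b)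
    (hc.intervalIntegrable b R)]
  have e1 : ∫ ρ in (0 : ℝ)..b, (1 - |ρ - b| / R) ^ n
      = ∫ ρ in (0 : ℝ)..b, (1 - (b - ρ) / R) ^ n := by
    refine intervalIntegral.integral_congr fun ρ hρ => ?_
    rw [Set.uIcc_of_le hb] at hρ
    rw [abs_of_nonpos (by linarith [hρ.2]), neg_sub]
  have e2 : ∫ ρ in b..R, (1 - |ρ - b| / R) ^ n = ∫ ρ in b..R, (1 - (ρ - b) / R) ^ n := by
    refine intervalIntegral.integral_congr fun ρ hρ => ?_
    rw [Set.uIcc_of_le hbR] at hρ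
    rw [abs_of_nonneg (by linarith [hρ.1])]
  have hn : ((n : ℝ) + 1) ≠ 0 := by positivity
  have i1 : ∫ ρ in (0 : ℝ)..b, (1 - (b - ρ) / R) ^ n
      = R / (n + 1) * (1 - (b - b) / R) ^ (n + 1) - R / (n + 1) * (1 - (b - 0) / R) ^ (n + 1) := by
    refine intervalIntegral.integral_eq_sub_of_hasDerivAt
      (f := fun ρ => R / (n + 1) * (1 - (b - ρ) / R) ^ (n + 1)) (fun ρ _ => ?_)
      (Continuous.intervalIntegrable (by fun_prop) _ _)
    have h := (((((hasDerivAt_id ρ).const_sub b).div_const R).const_sub 1).pow (n + 1)).const_mul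
      (R / ((n : ℝ) + 1))
    refine h.congr_deriv ?_
    push_cast
    simp only [id]
    field_simp
  have i2 : ∫ ρ in b..R, (1 - (ρ - b) / R) ^ n
      = -(R / (n + 1)) * (1 - (R - b) / R) ^ (n + 1)
        - -(R / (n + 1)) * (1 - (b - b) / R) ^ (n + 1) := by
    refine intervalIntegral.integral_eq_sub_of_hasDerivAt
      (f := fun ρ => -(R / (n + 1)) * (1 - (ρ - b) / R) ^ (n + 1)) (fun ρ _ => ?_)
      (Continuous.intervalIntegrable (by fun_prop) _ _)
    have h := (((((hasDerivAt_id ρ).sub_const b).div_const R).const_sub 1).pow (n + 1)).const_mul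
      (-(R / ((n : ℝ) + 1)))
    refine h.congr_deriv ?_
    push_cast
    simp only [id]
    field_simp
  have p1 : 0 ≤ R / (n + 1) * (1 - (b - 0) / R) ^ (n + 1) := by
    have : 0 ≤ 1 - (b - 0) / R := by
      rw [sub_zero, sub_nonneg, div_le_one hR]; exact hbR
    positivity
  have p2 : 0 ≤ R / (n + 1) * (1 - (R - b) / R) ^ (n + 1) := by
    have : 0 ≤ 1 - (R - b) / R := by
      rw [sub_nonneg, div_le_one hR]; linarith
    positivity
  rw [e1, e2, i1, i2, sub_self, zero_div, sub_zero, one_pow, mul_one, mul_one,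
    show 2 * R / ((n : ℝ) + 1) = R / (n + 1) + R / (n + 1) by ring]
  linarith

theorem norm_radialOperator_le {κ R : ℝ} (hκ : 0 < κ) (hR : 0 < R) (M v : ℝ → ℝ → ℂ) (n : ℕ)
    {a S : ℝ} (ha : 0 ≤ a) (hS : ∀ ρ ∈ Set.Ioc 0 R, ‖angularIntegral M v n ρ‖ ≤ S) :
    ‖radialOperator κ R M n v a‖
      ≤ 4 * κ ^ 2 * R ^ 2 * (1 + κ * R) * Real.exp ((κ * R) ^ 2) ^ 2 * (S / (n + 1)) := by
  have hS0 : 0 ≤ S := (norm_nonneg _).trans (hS R ⟨hR, le_rfl⟩)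
  set b := min a R with hb
  have hb0 : 0 ≤ b := le_min ha hR.le
  have hbR : b ≤ R := min_le_right _ _
  set C := 2 * (1 + κ * R) * Real.exp ((κ * R) ^ 2) ^ 2 / (κ * (2 * n + 1)) with hC
  have hC0 : 0 ≤ C := by positivity
  have hbound : ∀ ρ ∈ Set.Ioc 0 R,
      ‖sphericalH n (κ * max a ρ) * (sphericalJ n (κ * min a ρ) : ℂ) *
        angularIntegral M v n ρ * (ρ : ℂ) ^ 2‖ ≤ C * S * R * (1 - |ρ - b| / R) ^ n := by
    intro ρ hρ
    have h1 := norm_sphericalH_mul_sphericalJ_le hκ n ha hρ.1 hρ.2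
    have h2 := sq_mul_min_pow_div_max_pow_le hb0 hbR hρ.1 hρ.2 n
    have hμ : 0 ≤ min b ρ := le_min hb0 hρ.1.le
    have hM : 0 < max b ρ := hρ.1.trans_le (le_max_right _ _)
    rw [norm_mul, norm_mul _ (angularIntegral M v n ρ), norm_pow, Complex.norm_real,
      Real.norm_eq_abs, abs_of_pos hρ.1]
    calc _ ≤ C * (min b ρ ^ n / max b ρ ^ (n + 1)) * S * ρ ^ 2 := by
          gcongr
          exact hS ρ hρ
      _ = C * S * (ρ ^ 2 * (min b ρ ^ n / max b ρ ^ (n + 1))) := by ring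
      _ ≤ C * S * (R * (1 - |ρ - b| / R) ^ n) := by gcongr
      _ = _ := by ring
  -- Only the majorant has to be integrable here.
  have hint := intervalIntegral.norm_integral_le_of_norm_le (μ := volume) hR.le
    (Filter.Eventually.of_forall hbound) (Continuous.intervalIntegrable (by fun_prop) _ _)
  rw [intervalIntegral.integral_const_mul] at hint
  have hint' := hint.trans (mul_le_mul_of_nonneg_left (integral_one_sub_abs_pow_le hR hb0 hbR n)
    (by positivity))
  have hcoef : ‖-((2 * (n : ℂ) + 1) * (κ : ℂ) ^ 3)‖ = (2 * n + 1) * κ ^ 3 := by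
    have : -((2 * (n : ℂ) + 1) * (κ : ℂ) ^ 3) = ((-((2 * n + 1) * κ ^ 3) : ℝ) : ℂ) := by
      push_cast; ring
    rw [this, Complex.norm_real, norm_neg, Real.norm_of_nonneg (by positivity)]
  rw [radialOperator, norm_mul, hcoef]
  refine (mul_le_mul_of_nonneg_left hint' (by positivity)).trans (le_of_eq ?_)
  rw [hC]
  field_simp
  ring

end HelmholtzScattering

/-! ### Expansion of the angular integral in triple products. -/

namespace HelmholtzScattering

open MeasureTheory

/-- The summand of index `(s, l)` in the integrand of the angular integral. -/
noncomputable def angularTerm (c d : ℂ) (l s n : ℕ) : C(ℝ, ℂ) where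
  toFun θ := d * (((legendreP s).eval (Real.cos θ) : ℝ) : ℂ) *
    (c * (((legendreP l).eval (Real.cos θ) : ℝ) : ℂ)) *
    (((legendreP n).eval (Real.cos θ) : ℝ) : ℂ) * ((Real.sin θ : ℝ) : ℂ)
  continuous_toFun := by fun_prop

theorem norm_legendreP_cos_le (n : ℕ) (θ : ℝ) :
    ‖(((legendreP n).eval (Real.cos θ) : ℝ) : ℂ)‖ ≤ 1 := by
  rw [Complex.norm_real, Real.norm_eq_abs]
  exact abs_legendreP_eval_le_one n ⟨Real.neg_one_le_cos θ, Real.cos_le_one θ⟩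

theorem norm_mul_legendreP_cos_le (c : ℂ) (n : ℕ) (θ : ℝ) :
    ‖c * (((legendreP n).eval (Real.cos θ) : ℝ) : ℂ)‖ ≤ ‖c‖ := by
  rw [norm_mul]
  exact mul_le_of_le_one_right (norm_nonneg _) (norm_legendreP_cos_le n θ)

theorem norm_angularTerm_le (c d : ℂ) (l s n : ℕ) (θ : ℝ) :
    ‖angularTerm c d l s n θ‖ ≤ ‖d‖ * ‖c‖ := by
  have hsin : ‖((Real.sin θ : ℝ) : ℂ)‖ ≤ 1 := by
    rw [Complex.norm_real]; exact Real.abs_sin_le_one θ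
  simp only [angularTerm, ContinuousMap.coe_mk]
  rw [norm_mul, norm_mul, norm_mul (d * _)]
  refine (mul_le_of_le_one_right (by positivity) hsin).trans ?_
  refine (mul_le_of_le_one_right (by positivity) (norm_legendreP_cos_le n θ)).trans ?_
  exact mul_le_mul (norm_mul_legendreP_cos_le d s θ) (norm_mul_legendreP_cos_le c l θ)
    (norm_nonneg _) (norm_nonneg _)

theorem integral_comp_cos_mul_sin {f : ℝ → ℝ} (hf : Continuous f) :
    ∫ θ in (0 : ℝ)..Real.pi, f (Real.cos θ) * Real.sin θ = ∫ x in (-1 : ℝ)..1, f x := by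
  have h := intervalIntegral.integral_comp_mul_deriv (a := 0) (b := Real.pi) (g := f)
    (fun x _ => Real.hasDerivAt_cos x) (by fun_prop) hf
  rw [Real.cos_zero, Real.cos_pi, intervalIntegral.integral_symm (-1) 1] at h
  rw [← neg_inj, ← h, ← intervalIntegral.integral_neg]
  simp

theorem integral_angularTerm (c d : ℂ) (l s n : ℕ) :
    ∫ θ in (0 : ℝ)..Real.pi, angularTerm c d l s n θ = d * c * (legendreTriple l s n : ℂ) := by
  rw [legendreTriple, ← integral_comp_cos_mul_sin (by fun_prop), ← intervalIntegral.integral_ofReal,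
    ← intervalIntegral.integral_const_mul]
  refine intervalIntegral.integral_congr fun θ _ => ?_
  simp only [angularTerm, ContinuousMap.coe_mk]
  push_cast
  ring

theorem abs_legendreTriple_le_two (l s n : ℕ) : |legendreTriple l s n| ≤ 2 := by
  have h := intervalIntegral.norm_integral_le_of_norm_le_const (a := (-1 : ℝ)) (b := 1) (C := 1)
    (f := fun x => (legendreP l).eval x * (legendreP s).eval x * (legendreP n).eval x)
    (fun x hx => by
      rw [Set.uIoc_of_le (by norm_num)] at hx
      have hx' : x ∈ Set.Icc (-1 : ℝ) 1 := ⟨hx.1.le, hx.2⟩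
      rw [Real.norm_eq_abs, abs_mul, abs_mul]
      exact mul_le_one₀ (mul_le_one₀ (abs_legendreP_eval_le_one l hx') (abs_nonneg _)
        (abs_legendreP_eval_le_one s hx')) (abs_nonneg _) (abs_legendreP_eval_le_one n hx'))
  norm_num at h
  exact h

theorem summable_mul_legendreTriple {c d : ℕ → ℂ} (hc : Summable fun l => ‖c l‖)
    (hd : Summable fun i => ‖d i‖) (N n : ℕ) :
    Summable fun z : ℕ × ℕ => ‖d z.1‖ * ‖c z.2‖ * |legendreTriple z.2 (N + z.1) n| := by
  refine Summable.of_nonneg_of_le (fun z => by positivity) (fun z => ?_)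
    ((hd.mul_of_nonneg hc (fun _ => norm_nonneg _) (fun _ => norm_nonneg _)).mul_right 2)
  gcongr
  exact abs_legendreTriple_le_two _ _ _

theorem norm_angularIntegral_le {m u : ℕ → ℝ → ℂ} {ρ : ℝ} {F : ℕ} (n : ℕ)
    (hc : Summable fun l => ‖m l ρ‖) (hd : Summable fun i => ‖u (F + 1 + i) ρ‖) :
    ‖angularIntegral (legendreSeries m) (legendreTail u F) n ρ‖
      ≤ ∑' z : ℕ × ℕ, ‖u (F + 1 + z.1) ρ‖ * ‖m z.2 ρ‖ *
          |legendreTriple z.2 (F + 1 + z.1) n| := by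
  set g : ℕ × ℕ → C(ℝ, ℂ) := fun z => angularTerm (m z.2 ρ) (u (F + 1 + z.1) ρ) z.2 (F + 1 + z.1) n
    with hg
  -- Summable sup norms on [0, π] justify integrating the double series term by term.
  have hsum : Summable fun z => ‖(g z).restrict
      (⟨Set.uIcc 0 Real.pi, isCompact_uIcc⟩ : TopologicalSpace.Compacts ℝ)‖ := by
    refine Summable.of_nonneg_of_le (fun z => norm_nonneg _) (fun z => ?_)
      (hd.mul_of_nonneg hc (fun _ => norm_nonneg _) (fun _ => norm_nonneg _))
    rw [ContinuousMap.norm_le _ (by positivity)]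
    exact fun x => norm_angularTerm_le _ _ _ _ _ _
  have hint : angularIntegral (legendreSeries m) (legendreTail u F) n ρ
      = ∫ θ in (0 : ℝ)..Real.pi, ∑' z, g z θ := by
    refine intervalIntegral.integral_congr fun θ _ => ?_
    simp only [legendreSeries, legendreTail]
    rw [tsum_mul_tsum_of_summable_norm, ← tsum_mul_right, ← tsum_mul_right]
    · rfl
    · exact Summable.of_nonneg_of_le (fun _ => norm_nonneg _)
        (fun i => norm_mul_legendreP_cos_le _ _ θ) hd
    · exact Summable.of_nonneg_of_le (fun _ => norm_nonneg _)
        (fun i => norm_mul_legendreP_cos_le _ _ θ) hc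
  rw [hint, ← intervalIntegral.tsum_intervalIntegral_eq_of_summable_norm hsum]
  refine tsum_of_norm_bounded (summable_mul_legendreTriple hc hd (F + 1) n).hasSum fun z => ?_
  rw [hg, integral_angularTerm, norm_mul, norm_mul, Complex.norm_real, Real.norm_eq_abs]

theorem sqrt_inv_le_rpow {x y : ℝ} (hx : 0 < x) (hxy : x ≤ y) : (√y)⁻¹ ≤ x ^ (-(1 / 2) : ℝ) := by
  rw [Real.rpow_neg hx.le, ← Real.sqrt_eq_rpow]
  gcongr

/-- Cauchy–Schwarz on P_s and P_n, with |P_l| ≤ 1: the second half power falls on n. -/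
theorem abs_legendreTriple_le_rpow_mul_succ (l : ℕ) {s : ℕ} (hs : 1 ≤ s) (n : ℕ) :
    |legendreTriple l s n| ≤ 2 * (s : ℝ) ^ (-(1 / 2) : ℝ) * ((n : ℝ) + 1) ^ (-(1 / 2) : ℝ) := by
  have hs' : (0 : ℝ) < s := by exact_mod_cast hs
  refine (abs_integral_legendreP_mul_le s n
    fun x hx => abs_legendreP_eval_le_one l hx).trans' (le_of_eq ?_) |>.trans ?_
  · rw [legendreTriple]
    congr 2; ext x; ring
  · rw [div_eq_mul_inv, mul_inv, ← mul_assoc]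
    gcongr
    · exact sqrt_inv_le_rpow hs' (by linarith)
    · exact sqrt_inv_le_rpow (by positivity) (by linarith)

/-- Cauchy–Schwarz on P_s and P_l, with |P_n| ≤ 1: the second half power falls on l. -/
theorem abs_legendreTriple_le_rpow_mul_rpow {l s : ℕ} (hl : 1 ≤ l) (hs : 1 ≤ s) (n : ℕ) :
    |legendreTriple l s n| ≤ 2 * (s : ℝ) ^ (-(1 / 2) : ℝ) * (l : ℝ) ^ (-(1 / 2) : ℝ) := by
  have hs' : (0 : ℝ) < s := by exact_mod_cast hs
  have hl' : (0 : ℝ) < l := by exact_mod_cast hl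
  refine (abs_integral_legendreP_mul_le s l
    fun x hx => abs_legendreP_eval_le_one n hx).trans' (le_of_eq ?_) |>.trans ?_
  · rw [legendreTriple]
    congr 2; ext x; ring
  · rw [div_eq_mul_inv, mul_inv, ← mul_assoc]
    gcongr
    · exact sqrt_inv_le_rpow hs' (by linarith)
    · exact sqrt_inv_le_rpow hl' (by linarith)

end HelmholtzScattering

/-! ### Power sums, the discrete convolution and the operator bound. -/

namespace HelmholtzScattering

/-- From log(1 + 1/x) ≥ 1/(x+1) ≥ 1/(2x) follows (1 + 1/x)^q ≥ 1 + q/(2x). The constant (2+q)/q is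
what makes the resulting inequality 1/x ≤ (2+q)/(2x+q) equivalent to x ≥ 1. -/
theorem rpow_le_telescope {q x : ℝ} (hq : 0 < q) (hx : 1 ≤ x) :
    x ^ (-(1 + q)) ≤ (2 + q) / q * (x ^ (-q) - (x + 1) ^ (-q)) := by
  have hx0 : 0 < x := by linarith
  have h1 : (x + 1) ^ (-q) = x ^ (-q) * (1 + 1 / x) ^ (-q) := by
    rw [← Real.mul_rpow hx0.le (by positivity)]
    congr 1
    field_simp
  have hlog : 1 / (2 * x) ≤ Real.log (1 + 1 / x) := by
    have h := Real.one_sub_inv_le_log_of_pos (by positivity : 0 < 1 + 1 / x)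
    refine le_trans ?_ h
    have e : 1 - (1 + 1 / x)⁻¹ = 1 / (x + 1) := by field_simp; ring
    rw [e]
    gcongr
    linarith
  have h2 : (1 + 1 / x) ^ (-q) ≤ 1 / (1 + q / (2 * x)) := by
    rw [Real.rpow_neg (by positivity), ← one_div]
    gcongr
    rw [Real.rpow_def_of_pos (by positivity)]
    refine le_trans ?_ (Real.add_one_le_exp _)
    have := mul_le_mul_of_nonneg_right hlog hq.le
    have e : 1 / (2 * x) * q = q / (2 * x) := by ring
    linarith
  have h3 : x⁻¹ ≤ (2 + q) / q * (1 - 1 / (1 + q / (2 * x))) := by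
    have e : (2 + q) / q * (1 - 1 / (1 + q / (2 * x))) = (2 + q) / (2 * x + q) := by
      field_simp
      ring
    rw [e, ← one_div, div_le_div_iff₀ hx0 (by positivity)]
    nlinarith
  have h4 : x ^ (-(1 + q)) = x ^ (-q) * x⁻¹ := by
    rw [show -(1 + q) = -q + -1 by ring, Real.rpow_add hx0, Real.rpow_neg_one]
  rw [h1, h4, show (2 + q) / q * (x ^ (-q) - x ^ (-q) * (1 + 1 / x) ^ (-q))
    = x ^ (-q) * ((2 + q) / q * (1 - (1 + 1 / x) ^ (-q))) by ring]
  gcongr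
  refine h3.trans ?_
  gcongr

theorem sum_add_rpow_le {q : ℝ} (hq : 0 < q) {d : ℕ} (hd : 1 ≤ d) (N : ℕ) :
    ∑ i ∈ Finset.range N, ((d + i : ℕ) : ℝ) ^ (-(1 + q)) ≤ (2 + q) / q * (d : ℝ) ^ (-q) := by
  have h : ∀ i ∈ Finset.range N, ((d + i : ℕ) : ℝ) ^ (-(1 + q))
      ≤ (2 + q) / q * (((d + i : ℕ) : ℝ) ^ (-q) - ((d + (i + 1) : ℕ) : ℝ) ^ (-q)) := by
    intro i _
    have h1 : (1 : ℝ) ≤ ((d + i : ℕ) : ℝ) := by exact_mod_cast hd.trans (Nat.le_add_right d i)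
    refine (rpow_le_telescope hq h1).trans (le_of_eq ?_)
    push_cast
    ring_nf
  refine (Finset.sum_le_sum h).trans ?_
  rw [← Finset.mul_sum, Finset.sum_range_sub' fun i => ((d + i : ℕ) : ℝ) ^ (-q)]
  gcongr
  have : 0 ≤ ((d + N : ℕ) : ℝ) ^ (-q) := by positivity
  simpa using this

theorem summable_add_rpow {q : ℝ} (hq : 0 < q) {d : ℕ} (hd : 1 ≤ d) :
    Summable fun i : ℕ => ((d + i : ℕ) : ℝ) ^ (-(1 + q)) :=
  summable_of_sum_range_le (fun _ => by positivity) (sum_add_rpow_le hq hd)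

theorem tsum_add_rpow_le {q : ℝ} (hq : 0 < q) {d : ℕ} (hd : 1 ≤ d) :
    ∑' i : ℕ, ((d + i : ℕ) : ℝ) ^ (-(1 + q)) ≤ (2 + q) / q * (d : ℝ) ^ (-q) :=
  (summable_add_rpow hq hd).tsum_le_of_sum_range_le (sum_add_rpow_le hq hd)

theorem tsum_le_of_eq_zero_of_le_rpow {q K : ℝ} (hq : 0 < q) {d : ℕ} (hd : 1 ≤ d)
    {f : ℕ → ℝ} (hf : Summable f) (h0 : ∀ l < d, f l = 0)
    (h : ∀ l, d ≤ l → f l ≤ K * (l : ℝ) ^ (-(1 + q))) (hK : 0 ≤ K) :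
    ∑' l, f l ≤ K * ((2 + q) / q * (d : ℝ) ^ (-q)) := by
  rw [← hf.sum_add_tsum_nat_add d,
    Finset.sum_eq_zero fun l hl => h0 l (Finset.mem_range.1 hl), zero_add]
  calc ∑' i, f (i + d) ≤ ∑' i : ℕ, K * ((d + i : ℕ) : ℝ) ^ (-(1 + q)) := by
        refine Summable.tsum_le_tsum (fun i => ?_) ((summable_nat_add_iff d).2 hf)
          ((summable_add_rpow hq hd).mul_left K)
        rw [add_comm]
        exact h _ (Nat.le_add_right d i)
    _ ≤ _ := by
        rw [tsum_mul_left]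
        gcongr
        exact tsum_add_rpow_le hq hd

/-- With s = F+1+i and e = F+1-n, only l ≥ s - n = e+i contributes. The sum over l turns
l^(-(γ+2+β)) into (e+i)^(-(γ+1+β)), the sum over i turns that into e^(-(γ+β)), and s^(-(γ+4.5)) ≤
F^(-(γ+4.5)) comes out. -/
theorem tsum_mul_legendreTriple_le {γ β ε : ℝ} (hβ : 0 ≤ β) (hγβ : 0 < γ + β)
    (hT : ∀ l s n : ℕ, 1 ≤ l → 1 ≤ s → |legendreTriple l s n|
      ≤ 2 * (s : ℝ) ^ (-(1 / 2) : ℝ) * ((l : ℝ) ^ (-β) * ((n : ℝ) + 1) ^ (-ε)))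
    {c d : ℕ → ℂ} {A B : ℝ} (hA : 0 ≤ A) (hB : 0 ≤ B) {F n : ℕ} (hF : 1 ≤ F) (hn : n ≤ F)
    (hγ : 0 ≤ γ)
    (hcs : Summable fun l => ‖c l‖) (hds : Summable fun i => ‖d i‖)
    (hc : ∀ l : ℕ, 1 ≤ l → ‖c l‖ ≤ A * (l : ℝ) ^ (-(γ + 2)))
    (hd : ∀ i : ℕ, ‖d i‖ ≤ B * ((F + 1 + i : ℕ) : ℝ) ^ (-(γ + 4))) :
    ∑' z : ℕ × ℕ, ‖d z.1‖ * ‖c z.2‖ * |legendreTriple z.2 (F + 1 + z.1) n|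
      ≤ 2 * ((2 + (γ + 1 + β)) / (γ + 1 + β)) * ((2 + (γ + β)) / (γ + β)) * A * B *
        (F : ℝ) ^ (-(γ + 4.5)) * (((n : ℝ) + 1) ^ (-ε) * ((F + 1 - n : ℕ) : ℝ) ^ (-(γ + β))) := by
  set e := F + 1 - n with he
  have he1 : 1 ≤ e := by omega
  have hF0 : (0 : ℝ) < F := by exact_mod_cast hF
  set C1 := (2 + (γ + 1 + β)) / (γ + 1 + β) with hC1
  have hC10 : 0 ≤ C1 := by positivity
  set K := 2 * A * B * (F : ℝ) ^ (-(γ + 4.5)) * ((n : ℝ) + 1) ^ (-ε) with hK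
  have hK0 : 0 ≤ K := by positivity
  have hsum := summable_mul_legendreTriple hcs hds (F + 1) n
  have hinner : ∀ i : ℕ, ∑' l, ‖d i‖ * ‖c l‖ * |legendreTriple l (F + 1 + i) n|
      ≤ K * C1 * ((e + i : ℕ) : ℝ) ^ (-(1 + (γ + β))) := by
    intro i
    have hsumi : Summable fun l => ‖d i‖ * ‖c l‖ * |legendreTriple l (F + 1 + i) n| :=
      hsum.prod_factor i
    have hzero : ∀ l < e + i, ‖d i‖ * ‖c l‖ * |legendreTriple l (F + 1 + i) n| = 0 := by
      intro l hl
      have hls : l + n < F + 1 + i := by omega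
      rw [legendreTriple_eq_zero hls, abs_zero, mul_zero]
    have hle : ∀ l, e + i ≤ l → ‖d i‖ * ‖c l‖ * |legendreTriple l (F + 1 + i) n|
        ≤ K * (l : ℝ) ^ (-(1 + (γ + 1 + β))) := by
      intro l hl
      -- As n ≤ F, e ≥ 1: the coefficient of index l = 0, for which no bound is assumed, never
      -- enters.
      have hl1 : 1 ≤ l := by omega
      have hl0 : (0 : ℝ) < l := by exact_mod_cast hl1
      have hs0 : (0 : ℝ) < ((F + 1 + i : ℕ) : ℝ) := by positivity
      have hFs : (F : ℝ) ≤ ((F + 1 + i : ℕ) : ℝ) := by exact_mod_cast (by omega)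
      calc ‖d i‖ * ‖c l‖ * |legendreTriple l (F + 1 + i) n|
          ≤ (B * ((F + 1 + i : ℕ) : ℝ) ^ (-(γ + 4))) * (A * (l : ℝ) ^ (-(γ + 2))) *
            (2 * ((F + 1 + i : ℕ) : ℝ) ^ (-(1 / 2) : ℝ) *
              ((l : ℝ) ^ (-β) * ((n : ℝ) + 1) ^ (-ε))) := by
            gcongr
            · exact hd i
            · exact hc l hl1
            · exact hT l _ n hl1 (by omega)
        _ = 2 * A * B * (((F + 1 + i : ℕ) : ℝ) ^ (-(γ + 4)) *
              ((F + 1 + i : ℕ) : ℝ) ^ (-(1 / 2) : ℝ)) * ((n : ℝ) + 1) ^ (-ε) *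
              ((l : ℝ) ^ (-(γ + 2)) * (l : ℝ) ^ (-β)) := by ring
        _ = 2 * A * B * ((F + 1 + i : ℕ) : ℝ) ^ (-(γ + 4.5)) * ((n : ℝ) + 1) ^ (-ε) *
              (l : ℝ) ^ (-(1 + (γ + 1 + β))) := by
            rw [← Real.rpow_add hs0, ← Real.rpow_add hl0]
            congr 3
            · congr 2; norm_num; ring
            · ring
        _ ≤ K * (l : ℝ) ^ (-(1 + (γ + 1 + β))) := by
            rw [hK]
            gcongr ?_ * _ * _
            refine mul_le_mul_of_nonneg_left ?_ (by positivity)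
            exact Real.rpow_le_rpow_of_nonpos hF0 hFs (by linarith)
    have hei : 1 ≤ e + i := by omega
    have hq1 : 0 < γ + 1 + β := by linarith
    refine (tsum_le_of_eq_zero_of_le_rpow hq1 hei hsumi hzero hle hK0).trans (le_of_eq ?_)
    rw [← hC1, show γ + 1 + β = 1 + (γ + β) by ring]
    ring
  have hout := (summable_add_rpow hγβ he1).mul_left (K * C1)
  rw [hsum.tsum_prod]
  refine (Summable.tsum_le_tsum hinner hsum.prod hout).trans ?_
  rw [tsum_mul_left]
  refine (mul_le_mul_of_nonneg_left (tsum_add_rpow_le hγβ he1) (by positivity)).trans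
    (le_of_eq ?_)
  rw [hK]
  ring

/-- For each n, at least one of n+1 and F+1-n is at least F/2; that factor is pulled out and the
other is summed in full. -/
theorem sum_succ_rpow_mul_rpow_le {p q : ℝ} (hp : 0 ≤ p) (hq : 0 ≤ q) {F : ℕ} (hF : 1 ≤ F) :
    ∑ n ∈ Finset.range (F + 1), ((n : ℝ) + 1) ^ (-p) * ((F + 1 - n : ℕ) : ℝ) ^ (-q)
      ≤ ((F : ℝ) / 2) ^ (-p) * ∑ n ∈ Finset.range (F + 1), ((n : ℝ) + 1) ^ (-q)
        + ((F : ℝ) / 2) ^ (-q) * ∑ n ∈ Finset.range (F + 1), ((n : ℝ) + 1) ^ (-p) := by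
  have hF0 : (0 : ℝ) < F := by exact_mod_cast hF
  have hflip : ∑ n ∈ Finset.range (F + 1), ((n : ℝ) + 1) ^ (-q)
      = ∑ n ∈ Finset.range (F + 1), ((F + 1 - n : ℕ) : ℝ) ^ (-q) := by
    rw [← Finset.sum_flip]
    refine Finset.sum_congr rfl fun n hn => ?_
    have hn' : n ≤ F := Nat.lt_succ_iff.1 (Finset.mem_range.1 hn)
    rw [Nat.cast_sub hn', Nat.cast_sub (by omega)]
    push_cast
    congr 1
    ring
  rw [hflip, Finset.mul_sum, Finset.mul_sum, ← Finset.sum_add_distrib]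
  refine Finset.sum_le_sum fun n hn => ?_
  have hn' : n ≤ F := Nat.lt_succ_iff.1 (Finset.mem_range.1 hn)
  have hy : ((F + 1 - n : ℕ) : ℝ) = F + 1 - n := by
    rw [Nat.cast_sub (by omega)]; push_cast; ring
  have hy0 : (0 : ℝ) ≤ ((F + 1 - n : ℕ) : ℝ) := by positivity
  rcases le_total ((F : ℝ) / 2) ((n : ℝ) + 1) with h | h
  · refine le_add_of_le_of_nonneg ?_ (by positivity)
    gcongr ?_ * _
    exact Real.rpow_le_rpow_of_nonpos (by positivity) h (by linarith)
  · refine le_add_of_nonneg_of_le (by positivity) ?_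
    rw [mul_comm]
    gcongr ?_ * _
    exact Real.rpow_le_rpow_of_nonpos (by positivity) (by rw [hy]; linarith) (by linarith)

theorem div_two_rpow_le {p r : ℝ} (hr : r ≤ p) {F : ℕ} (hF : 1 ≤ F) :
    ((F : ℝ) / 2) ^ (-p) ≤ 2 ^ p * (F : ℝ) ^ (-r) := by
  have hF1 : (1 : ℝ) ≤ F := by exact_mod_cast hF
  rw [Real.div_rpow (by positivity) (by norm_num), Real.rpow_neg (by norm_num : (0 : ℝ) ≤ 2),
    div_inv_eq_mul, mul_comm]
  gcongr

theorem sum_succ_rpow_le {p : ℝ} (hp : 1 < p) (N : ℕ) :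
    ∑ n ∈ Finset.range N, ((n : ℝ) + 1) ^ (-p) ≤ (1 + p) / (p - 1) := by
  have h := sum_add_rpow_le (sub_pos.2 hp) le_rfl N
  rw [Nat.cast_one, Real.one_rpow, mul_one] at h
  refine le_trans (le_of_eq ?_) (h.trans (le_of_eq ?_))
  · refine Finset.sum_congr rfl fun n _ => ?_
    push_cast
    congr 1 <;> ring
  · congr 1; ring

theorem sum_convolution_le_min {p q : ℝ} (hp : 1 < p) (hq : 1 < q) {F : ℕ} (hF : 1 ≤ F) :
    ∑ n ∈ Finset.range (F + 1), ((n : ℝ) + 1) ^ (-p) * ((F + 1 - n : ℕ) : ℝ) ^ (-q)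
      ≤ (2 ^ p * ((1 + q) / (q - 1)) + 2 ^ q * ((1 + p) / (p - 1))) *
        (F : ℝ) ^ (-(min p q)) := by
  have hp' : 0 < p - 1 := sub_pos.2 hp
  have hq' : 0 < q - 1 := sub_pos.2 hq
  refine (sum_succ_rpow_mul_rpow_le (by linarith) (by linarith) hF).trans ?_
  rw [add_mul]
  calc _ ≤ (2 ^ p * (F : ℝ) ^ (-(min p q))) * ((1 + q) / (q - 1))
        + (2 ^ q * (F : ℝ) ^ (-(min p q))) * ((1 + p) / (p - 1)) := by
        gcongr
        · exact div_two_rpow_le (min_le_left _ _) hF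
        · exact sum_succ_rpow_le hq _
        · exact div_two_rpow_le (min_le_right _ _) hF
        · exact sum_succ_rpow_le hp _
    _ = _ := by ring

theorem sum_succ_rpow_neg_one_le_log {F : ℕ} (hF : 2 ≤ F) :
    ∑ n ∈ Finset.range (F + 1), ((n : ℝ) + 1) ^ (-1 : ℝ) ≤ 4 * Real.log F := by
  have hF2 : (2 : ℝ) ≤ F := by exact_mod_cast hF
  have h := harmonic_le_one_add_log (F + 1)
  have e : ((harmonic (F + 1) : ℚ) : ℝ) = ∑ n ∈ Finset.range (F + 1), ((n : ℝ) + 1) ^ (-1 : ℝ) := by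
    simp [harmonic, Real.rpow_neg_one]
  rw [e] at h
  -- F + 1 ≤ F² for F ≥ 2; the constant 1 is at most 2 log F because log 2 > 1/2.
  have h1 : Real.log ((F + 1 : ℕ) : ℝ) ≤ 2 * Real.log F := by
    rw [← Real.log_rpow (by linarith), Real.rpow_two]
    refine Real.log_le_log (by positivity) ?_
    push_cast
    nlinarith
  have h2 : Real.log 2 ≤ Real.log F := Real.log_le_log (by norm_num) hF2
  have := Real.log_two_gt_d9
  linarith

theorem sum_convolution_le_log {q : ℝ} (hq : 0 < q) {F : ℕ} (hF : 2 ≤ F) :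
    ∑ n ∈ Finset.range (F + 1), ((n : ℝ) + 1) ^ (-1 : ℝ) * ((F + 1 - n : ℕ) : ℝ) ^ (-q)
      ≤ (16 + 4 * 2 ^ q) * (Real.log F * (F : ℝ) ^ (-(min 1 q))) := by
  have hF2 : (2 : ℝ) ≤ F := by exact_mod_cast hF
  have hF0 : (0 : ℝ) < F := by linarith
  have hlog : 0 ≤ Real.log F := Real.log_nonneg (by linarith)
  have hH := sum_succ_rpow_neg_one_le_log hF
  set μ := min 1 q with hμ
  have hμ1 : μ ≤ 1 := min_le_left _ _
  have hμ0 : 0 < μ := lt_min one_pos hq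
  -- When q < 1 the sum grows like a power. Comparing with the harmonic sum, (n+1)^(-q) ≤
  -- (n+1)^(1-μ) (n+1)^(-1), covers all q > 0 at the price of a logarithm.
  have hS : ∑ n ∈ Finset.range (F + 1), ((n : ℝ) + 1) ^ (-q)
      ≤ 2 * (F : ℝ) ^ (1 - μ) * (4 * Real.log F) := by
    refine le_trans ?_ (mul_le_mul_of_nonneg_left hH (by positivity))
    rw [Finset.mul_sum]
    refine Finset.sum_le_sum fun n hn => ?_
    have hn' : (n : ℝ) ≤ F := by exact_mod_cast Nat.lt_succ_iff.1 (Finset.mem_range.1 hn)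
    calc ((n : ℝ) + 1) ^ (-q) ≤ ((n : ℝ) + 1) ^ ((1 - μ) + -1) := by
          refine Real.rpow_le_rpow_of_exponent_le (by simp) ?_
          have := min_le_right 1 q
          linarith
      _ = ((n : ℝ) + 1) ^ (1 - μ) * ((n : ℝ) + 1) ^ (-1 : ℝ) := Real.rpow_add (by positivity) _ _
      _ ≤ 2 * (F : ℝ) ^ (1 - μ) * ((n : ℝ) + 1) ^ (-1 : ℝ) := by
          gcongr
          calc ((n : ℝ) + 1) ^ (1 - μ) ≤ (2 * (F : ℝ)) ^ (1 - μ) := by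
                refine Real.rpow_le_rpow (by positivity) (by linarith) (by linarith)
            _ = 2 ^ (1 - μ) * (F : ℝ) ^ (1 - μ) := Real.mul_rpow (by norm_num) hF0.le
            _ ≤ 2 ^ (1 : ℝ) * (F : ℝ) ^ (1 - μ) := by
                gcongr
                · norm_num
                · linarith
            _ = _ := by rw [Real.rpow_one]
  refine (sum_succ_rpow_mul_rpow_le zero_le_one hq.le (by omega)).trans ?_
  have h1 : ((F : ℝ) / 2) ^ (-1 : ℝ) = 2 * (F : ℝ) ^ (-1 : ℝ) := by
    rw [Real.rpow_neg_one, Real.rpow_neg_one, inv_div]; rfl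
  have h2 := div_two_rpow_le (min_le_right 1 q) (by omega : 1 ≤ F)
  have h3 : (F : ℝ) ^ (-1 : ℝ) * (F : ℝ) ^ (1 - μ) = (F : ℝ) ^ (-μ) := by
    rw [← Real.rpow_add hF0]; congr 1; ring
  calc _ ≤ (2 * (F : ℝ) ^ (-1 : ℝ)) * (2 * (F : ℝ) ^ (1 - μ) * (4 * Real.log F))
        + (2 ^ q * (F : ℝ) ^ (-μ)) * (4 * Real.log F) := by
        rw [h1]
        gcongr
    _ = 16 * Real.log F * ((F : ℝ) ^ (-1 : ℝ) * (F : ℝ) ^ (1 - μ))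
        + 4 * 2 ^ q * Real.log F * (F : ℝ) ^ (-μ) := by ring
    _ = _ := by rw [h3]; ring

/-- The operator bound, reduced to a discrete convolution. -/
theorem norm_truncatedOperator_le {κ R : ℝ} (hκ : 0 < κ) (hR : 0 < R) {γ β ε : ℝ} (hγ : 0 ≤ γ)
    (hβ : 0 ≤ β) (hγβ : 0 < γ + β)
    (hT : ∀ l s n : ℕ, 1 ≤ l → 1 ≤ s → |legendreTriple l s n|
      ≤ 2 * (s : ℝ) ^ (-(1 / 2) : ℝ) * ((l : ℝ) ^ (-β) * ((n : ℝ) + 1) ^ (-ε)))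
    {m u : ℕ → ℝ → ℂ} {A B : ℝ} (hA : 0 ≤ A) (hB : 0 ≤ B)
    (hm : ∀ l : ℕ, 1 ≤ l → ∀ ρ ∈ Set.Icc 0 R, ‖m l ρ‖ ≤ A * (l : ℝ) ^ (-(γ + 2)))
    (hu : ∀ s : ℕ, 1 ≤ s → ∀ ρ ∈ Set.Icc 0 R, ‖u s ρ‖ ≤ B * (s : ℝ) ^ (-(γ + 4)))
    {F : ℕ} (hF : 1 ≤ F) {a : ℝ} (ha : 0 ≤ a) (θ : ℝ) :
    ‖truncatedOperator κ R (legendreSeries m) F (legendreTail u F) a θ‖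
      ≤ 4 * κ ^ 2 * R ^ 2 * (1 + κ * R) * Real.exp ((κ * R) ^ 2) ^ 2 *
        (2 * ((2 + (γ + 1 + β)) / (γ + 1 + β)) * ((2 + (γ + β)) / (γ + β))) * A * B *
        (F : ℝ) ^ (-(γ + 4.5)) *
        ∑ n ∈ Finset.range (F + 1),
          ((n : ℝ) + 1) ^ (-(1 + ε)) * ((F + 1 - n : ℕ) : ℝ) ^ (-(γ + β)) := by
  rw [truncatedOperator, Finset.mul_sum]
  refine norm_sum_le_of_le _ fun n hn => ?_
  have hn' : n ≤ F := Nat.lt_succ_iff.1 (Finset.mem_range.1 hn)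
  refine (norm_mul_legendreP_cos_le _ _ _).trans ?_
  refine (norm_radialOperator_le hκ hR _ _ n ha (S := 2 * ((2 + (γ + 1 + β)) / (γ + 1 + β)) *
    ((2 + (γ + β)) / (γ + β)) * A * B * (F : ℝ) ^ (-(γ + 4.5)) *
    (((n : ℝ) + 1) ^ (-ε) * ((F + 1 - n : ℕ) : ℝ) ^ (-(γ + β)))) fun ρ hρ => ?_).trans
    (le_of_eq ?_)
  · have hρ' : ρ ∈ Set.Icc 0 R := ⟨hρ.1.le, hρ.2⟩
    have hcs : Summable fun l => ‖m l ρ‖ := by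
      rw [← summable_nat_add_iff 1]
      refine Summable.of_nonneg_of_le (fun _ => norm_nonneg _)
        (fun l => hm (l + 1) (by omega) ρ hρ') (Summable.mul_left A ?_)
      have h := summable_add_rpow (q := γ + 1) (by linarith) (le_refl 1)
      refine h.congr fun l => ?_
      rw [add_comm 1 l]
      congr 1; ring
    have hd : ∀ i : ℕ, ‖u (F + 1 + i) ρ‖ ≤ B * ((F + 1 + i : ℕ) : ℝ) ^ (-(γ + 4)) :=
      fun i => hu _ (by omega) ρ hρ'
    have hds : Summable fun i => ‖u (F + 1 + i) ρ‖ := by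
      refine Summable.of_nonneg_of_le (fun _ => norm_nonneg _) hd (Summable.mul_left B ?_)
      have h := summable_add_rpow (q := γ + 3) (by linarith) (by omega : 1 ≤ F + 1)
      refine h.congr fun l => ?_
      congr 1; ring
    exact (norm_angularIntegral_le n hcs hds).trans
      (tsum_mul_legendreTriple_le hβ hγβ hT hA hB hF hn' hγ hcs hds
        (fun l hl => hm l hl ρ hρ') hd)
  -- The radial gain 1/(n+1) raises the exponent ε to 1 + ε.
  · have h : ((n : ℝ) + 1) ^ (-(1 + ε)) = ((n : ℝ) + 1) ^ (-ε) / (n + 1) := by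
      rw [neg_add, add_comm, Real.rpow_add (by positivity), Real.rpow_neg_one, div_eq_mul_inv, mul_comm]
    rw [h]
    ring

end HelmholtzScattering

/-! ### Choice of exponents in the two regimes. -/

theorem mainTheorem2 (κ R : ℝ) (hκ : 0 < κ) (hR : 0 < R) (k : ℕ) (α : ℝ) (hα : 0 < α) :
    ∃ C : ℝ, 0 < C ∧
      ∀ (m u : ℕ → ℝ → ℂ) (A B : ℝ),
        (∀ l, MeasureTheory.AEStronglyMeasurable (m l)
          (MeasureTheory.volume.restrict (Set.Icc 0 R))) →
        (∀ s, MeasureTheory.AEStronglyMeasurable (u s)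
          (MeasureTheory.volume.restrict (Set.Icc 0 R))) →
        (∀ l : ℕ, 1 ≤ l → ∀ ρ ∈ Set.Icc 0 R,
          ‖m l ρ‖ ≤ A * (l : ℝ) ^ (-((k : ℝ) + 2 + α))) →
        (∀ s : ℕ, 1 ≤ s → ∀ ρ ∈ Set.Icc 0 R,
          ‖u s ρ‖ ≤ B * (s : ℝ) ^ (-((k : ℝ) + 4 + α))) →
        (1 ≤ k → ∀ F : ℕ, 1 ≤ F → ∀ a : ℝ, 0 ≤ a → ∀ θ : ℝ,
          ‖HelmholtzScattering.truncatedOperator κ R (HelmholtzScattering.legendreSeries m) F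
              (HelmholtzScattering.legendreTail u F) a θ‖
            ≤ C * A * B * (F : ℝ) ^ (-((k : ℝ) + 4.5 + α + min 1.5 ((k : ℝ) + α)))) ∧
        (k = 0 → ∀ F : ℕ, 2 ≤ F → ∀ a : ℝ, 0 ≤ a → ∀ θ : ℝ,
          ‖HelmholtzScattering.truncatedOperator κ R (HelmholtzScattering.legendreSeries m) F
              (HelmholtzScattering.legendreTail u F) a θ‖
            ≤ C * A * B * (Real.log F * (F : ℝ) ^ (-(4.5 + α + min 1 (0.5 + α))))) := by
  set γ : ℝ := k + α with hγdef
  have hγ : 0 < γ := by positivity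
  set c : ℝ := 4 * κ ^ 2 * R ^ 2 * (1 + κ * R) * Real.exp ((κ * R) ^ 2) ^ 2 with hc
  have hc0 : 0 < c := by positivity
  -- Used for k ≥ 1, with β = 0 and ε = 1/2: the convolution exponents are 3/2 and γ > 1.
  have hT0 : ∀ l s n : ℕ, 1 ≤ l → 1 ≤ s → |HelmholtzScattering.legendreTriple l s n|
      ≤ 2 * (s : ℝ) ^ (-(1 / 2) : ℝ) *
        ((l : ℝ) ^ (-(0 : ℝ)) * ((n : ℝ) + 1) ^ (-(1 / 2) : ℝ)) := fun l s n _ hs => by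
    simpa using HelmholtzScattering.abs_legendreTriple_le_rpow_mul_succ l hs n
  -- Used for k = 0, with β = 1/2 and ε = 0: the convolution exponents are 1 and α + 1/2.
  have hT1 : ∀ l s n : ℕ, 1 ≤ l → 1 ≤ s → |HelmholtzScattering.legendreTriple l s n|
      ≤ 2 * (s : ℝ) ^ (-(1 / 2) : ℝ) *
        ((l : ℝ) ^ (-(1 / 2) : ℝ) * ((n : ℝ) + 1) ^ (-(0 : ℝ))) := fun l s n hl hs => by
    simpa using HelmholtzScattering.abs_legendreTriple_le_rpow_mul_rpow hl hs n
  set D : ℝ → ℝ := fun β => 2 * ((2 + (γ + 1 + β)) / (γ + 1 + β)) * ((2 + (γ + β)) / (γ + β))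
    with hD
  have hDpos : ∀ β : ℝ, 0 ≤ β → 0 < D β := fun β hβ => by positivity
  set E0 : ℝ := 2 ^ (3 / 2 : ℝ) * ((1 + γ) / (γ - 1)) +
    2 ^ γ * ((1 + 3 / 2) / (3 / 2 - 1)) with hE0
  set E1 : ℝ := 16 + 4 * 2 ^ (γ + 1 / 2) with hE1
  have hE1pos : 0 < E1 := by positivity
  -- One constant serves both regimes. The absolute value is needed because γ - 1 in `E0` may be
  -- negative when k = 0.
  refine ⟨c * D 0 * |E0| + c * D (1 / 2) * E1, by
    have := hDpos 0 le_rfl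
    have := hDpos (1 / 2) (by norm_num)
    positivity, fun m u A B _ _ hm hu => ?_⟩
  have hC0 : 0 ≤ c * D 0 * |E0| := by
    have := hDpos 0 le_rfl
    positivity
  have hC1 : 0 ≤ c * D (1 / 2) * E1 := by
    have := hDpos (1 / 2) (by norm_num)
    positivity
  have hA : 0 ≤ A := by
    simpa using (norm_nonneg _).trans (hm 1 le_rfl 0 ⟨le_rfl, hR.le⟩)
  have hB : 0 ≤ B := by
    simpa using (norm_nonneg _).trans (hu 1 le_rfl 0 ⟨le_rfl, hR.le⟩)
  have hm' : ∀ l : ℕ, 1 ≤ l → ∀ ρ ∈ Set.Icc 0 R, ‖m l ρ‖ ≤ A * (l : ℝ) ^ (-(γ + 2)) := by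
    intro l hl ρ hρ
    rw [show γ + 2 = k + 2 + α by rw [hγdef]; ring]
    exact hm l hl ρ hρ
  have hu' : ∀ s : ℕ, 1 ≤ s → ∀ ρ ∈ Set.Icc 0 R, ‖u s ρ‖ ≤ B * (s : ℝ) ^ (-(γ + 4)) := by
    intro s hs ρ hρ
    rw [show γ + 4 = k + 4 + α by rw [hγdef]; ring]
    exact hu s hs ρ hρ
  constructor
  · intro hk F hF a ha θ
    have hF0 : (0 : ℝ) < F := by exact_mod_cast hF
    have hk' : (1 : ℝ) ≤ k := by exact_mod_cast hk
    have hγ1 : 1 < γ := by linarith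
    have h := HelmholtzScattering.norm_truncatedOperator_le hκ hR hγ.le le_rfl (by linarith) hT0
      hA hB hm' hu' hF ha θ
    have hs := HelmholtzScattering.sum_convolution_le_min (p := 3 / 2) (q := γ) (by norm_num)
      hγ1 hF
    rw [← hE0] at hs
    have hDp := hDpos 0 le_rfl
    rw [show (1 : ℝ) + 1 / 2 = 3 / 2 by norm_num, add_zero] at h
    calc _ ≤ c * D 0 * A * B * (F : ℝ) ^ (-(γ + 4.5)) *
          ∑ n ∈ Finset.range (F + 1),
            ((n : ℝ) + 1) ^ (-(3 / 2) : ℝ) * ((F + 1 - n : ℕ) : ℝ) ^ (-γ) := by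
          simpa [hD] using h
      _ ≤ c * D 0 * A * B * (F : ℝ) ^ (-(γ + 4.5)) * (|E0| * (F : ℝ) ^ (-(min (3 / 2) γ))) := by
          gcongr
          exact hs.trans (mul_le_mul_of_nonneg_right (le_abs_self _) (by positivity))
      _ = (c * D 0 * |E0|) * A * B *
          ((F : ℝ) ^ (-(γ + 4.5)) * (F : ℝ) ^ (-(min (3 / 2) γ))) := by ring
      _ = (c * D 0 * |E0|) * A * B * (F : ℝ) ^ (-((k : ℝ) + 4.5 + α + min 1.5 γ)) := by
          rw [← Real.rpow_add hF0, show (1.5 : ℝ) = 3 / 2 by norm_num]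
          congr 2
          rw [hγdef]; ring
      _ ≤ _ := by
          gcongr
          linarith
  · intro hk F hF a ha θ
    have hF2 : (2 : ℝ) ≤ F := by exact_mod_cast hF
    have hF0 : (0 : ℝ) < F := by linarith
    have hlog : 0 ≤ Real.log F := Real.log_nonneg (by linarith)
    have hγα : γ = α := by rw [hγdef, hk]; simp
    have h := HelmholtzScattering.norm_truncatedOperator_le hκ hR hγ.le (by norm_num)
      (by linarith) hT1 hA hB hm' hu' (by omega : 1 ≤ F) ha θ
    have hs := HelmholtzScattering.sum_convolution_le_log (q := γ + 1 / 2) (by linarith) hF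
    rw [← hE1] at hs
    have hDp := hDpos (1 / 2) (by norm_num)
    rw [add_zero] at h
    calc _ ≤ c * D (1 / 2) * A * B * (F : ℝ) ^ (-(γ + 4.5)) *
          ∑ n ∈ Finset.range (F + 1),
            ((n : ℝ) + 1) ^ (-1 : ℝ) * ((F + 1 - n : ℕ) : ℝ) ^ (-(γ + 1 / 2)) := h
      _ ≤ c * D (1 / 2) * A * B * (F : ℝ) ^ (-(γ + 4.5)) *
          (E1 * (Real.log F * (F : ℝ) ^ (-(min 1 (γ + 1 / 2))))) := by
          gcongr
      _ = (c * D (1 / 2) * E1) * A * B * (Real.log F *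
          ((F : ℝ) ^ (-(γ + 4.5)) * (F : ℝ) ^ (-(min 1 (γ + 1 / 2))))) := by ring
      _ = (c * D (1 / 2) * E1) * A * B *
          (Real.log F * (F : ℝ) ^ (-(4.5 + α + min 1 (0.5 + α)))) := by
          rw [← Real.rpow_add hF0, hγα, show (0.5 : ℝ) + α = α + 1 / 2 by norm_num; ring]
          congr 3
          ring
      _ ≤ _ := by
          gcongr
          linarith
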